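/- Let $A \in \mathbb{R}^{n \times n}$, $B \in \mathbb{R}^{n \times m}$ and $M = M^T \in \mathbb{R}^{(n+m)\times(n+m)}$, and suppose that $(A,B)$ is controllable, i.e. for all $x_0, x_1 \in \mathbb{R}^n$ there are $t_1 \ge 0$ and continuous $x : [0,t_1] \to \mathbb{R}^n$, $u : [0,t_1] \to \mathbb{R}^m$ with $\dot x = Ax + Bu$ on $[0,t_1]$, $x(0) = x_0$ and $x(t_1) = x_1$. Here a differential equation $\dot x = Ax + Bu$ on an interval $J$ is understood in the integrated sense $x(t) - x(s) = \int_s^t (Ax(\tau) + Bu(\tau))\,\mathrm{d}\tau$ for all $s, t \in J$, and $N \preceq 0$ means that the (real symmetric or complex Hermitian) matrix $N$ is negative semidefinite. Then the following statements are equivalent: (i) There exists $P \in \mathbb{R}^{n \times n}$ with $P = P^T$ and $$M + \begin{pmatrix} A^T P + PA & PB \\ B^T P & 0 \end{pmatrix} \preceq 0.$$ (ii) For all $x \in \mathbb{C}^n$ and $u \in \mathbb{C}^m$ such that either $x = 0$ or $i\omega x = Ax + Bu$ for some $\omega \in \mathbb{R}$, $$\begin{pmatrix} x \\ u \end{pmatrix}^{*}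 M \begin{pmatrix} x \\ u \end{pmatrix} \le 0,$$ where $^*$ denotes the conjugate transpose. (iii) For all almost everywhere continuous functions $x \in L_2^n(-\infty,\infty)$ and $u \in L_2^m(-\infty,\infty)$ (real-valued in each component) such that either $x = 0$ or $\dot x = Ax + Bu$ on $\mathbb{R}$, $$\int_{-\infty}^{\infty} \begin{pmatrix} x(t) \\ u(t) \end{pmatrix}^T M \begin{pmatrix} x(t) \\ u(t) \end{pmatrix} \mathrm{d}t \le 0.$$ (iv) For all $\omega \in \mathbb{R}$ such that $i\omega$ is not an eigenvalue of $A$, $$\begin{pmatrix} (i\omega I - A)^{-1}B \\ I \end{pmatrix}^{*} M \begin{pmatrix} (i\omega I - A)^{-1}B \\ I \end{pmatrix} \preceq 0.$$ -/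

import Mathlib

open MeasureTheory Matrix
open scoped ComplexOrder

/-- The functions `x` (state) and `u` (input) satisfy the differential equation `ẋ = A x + B u`
on the interval `J`, in integrated form: `x t - x s = ∫ τ in s..t, (A x(τ) + B u(τ))` for all
`s, t ∈ J`, the integrand being integrable. -/
def SatisfiesLTI {n m : ℕ} (A : Matrix (Fin n) (Fin n) ℝ) (B : Matrix (Fin n) (Fin m) ℝ)
    (J : Set ℝ) (x : ℝ → Fin n → ℝ) (u : ℝ → Fin m → ℝ) : Prop :=
  ∀ s ∈ J, ∀ t ∈ J,
    IntervalIntegrable (fun τ => A *ᵥ x τ + B *ᵥ u τ) volume s t ∧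
      x t - x s = ∫ τ in s..t, (A *ᵥ x τ + B *ᵥ u τ)

/-- `(A, B)` is controllable: any state can be steered to any other state in finite time by a
continuous input. -/
def Controllable {n m : ℕ} (A : Matrix (Fin n) (Fin n) ℝ) (B : Matrix (Fin n) (Fin m) ℝ) : Prop :=
  ∀ x₀ x₁ : Fin n → ℝ, ∃ t₁ : ℝ, 0 ≤ t₁ ∧
    ∃ (x : ℝ → Fin n → ℝ) (u : ℝ → Fin m → ℝ),
      ContinuousOn x (Set.Icc 0 t₁) ∧ ContinuousOn u (Set.Icc 0 t₁) ∧
        SatisfiesLTI A B (Set.Icc 0 t₁) x u ∧ x 0 = x₀ ∧ x t₁ = x₁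

/-- A real matrix regarded as a complex matrix. -/
def Matrix.toComplex {ι κ : Type*} (N : Matrix ι κ ℝ) : Matrix ι κ ℂ :=
  N.map (fun a => (a : ℂ))

/-- The matrix `[(i ω I - A)⁻¹ B; I]`. -/
noncomputable def frequencyMatrix {n m : ℕ} (A : Matrix (Fin n) (Fin n) ℝ)
    (B : Matrix (Fin n) (Fin m) ℝ) (ω : ℝ) : Matrix (Fin n ⊕ Fin m) (Fin m) ℂ :=
  Matrix.fromRows
    (((Complex.I * (ω : ℂ)) • (1 : Matrix (Fin n) (Fin n) ℂ) - A.toComplex)⁻¹ * B.toComplex) 1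

/-! The cycle is (i) → (iii) → (ii) → (i), together with (ii) ↔ (iv).

(i) → (iii): along a trajectory the quadratic form of `lmiBlock A B P` is the derivative of `xᵀ P
x`, so a solution `P` is a storage function, and the cost over `[-T, T]` is at most a boundary term
that tends to zero (`integral_quad_nonpos`).

(iii) → (ii): a complex solution of `iω x = A x + B u` gives real sinusoidal trajectories.
Controllability lets them be entered from the origin and left towards it at a cost independent of
their duration. Running for many periods would make the total cost positive if the Hermitian form
were positive (`hermQuad_nonpos_of_integral`).

(ii) → (i): the inequality is solvable exactly when `-M` lies in the convex cone `lmiCone A B`.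
Controllability bounds storage functions by the size of `M`, and compactness then makes the cone
closed (`Controllable.isClosed_lmiCone`). If `-M` were outside, a separating functional would be a
sum of evaluations `N ↦ zᵀ N z` that kills every block `lmiBlock A B P` and is positive at `M`.
Killing the blocks says that `(A X + B U) Xᵀ` is skew-symmetric, where the columns of `[X; U]` are
the vectors `z`. A skew matrix has imaginary eigenvalues, and its eigenvectors recombine the columns
into vectors admissible in (ii), so the functional is nonpositive at `M` (`trace_nonpos_of_skew`).

(iv) → (ii): the case `x = 0` is the limit of infinite frequency. At an eigenvalue `iω` of `A`, the
Hautus test allows a solution to be deformed to nearby regular frequencies. -/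

/-- The value `zᵀ N z` of the quadratic form of a real matrix. -/
def Matrix.quad {ι : Type*} [Fintype ι] (N : Matrix ι ι ℝ) (z : ι → ℝ) : ℝ :=
  z ⬝ᵥ (N *ᵥ z)

/-- The block matrix of the linear matrix inequality. -/
def lmiBlock {n m : ℕ} (A : Matrix (Fin n) (Fin n) ℝ) (B : Matrix (Fin n) (Fin m) ℝ)
    (P : Matrix (Fin n) (Fin n) ℝ) : Matrix (Fin n ⊕ Fin m) (Fin n ⊕ Fin m) ℝ :=
  Matrix.fromBlocks (Aᵀ * P + P * A) (P * B) (Bᵀ * P) 0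

/-! ### Real quadratic forms and the block of the inequality. -/

namespace Matrix

lemma quad_add_left {ι : Type*} [Fintype ι] (N N' : Matrix ι ι ℝ) (z : ι → ℝ) :
    (N + N').quad z = N.quad z + N'.quad z := by
  simp [quad, add_mulVec, dotProduct_add]

lemma quad_neg {ι : Type*} [Fintype ι] (N : Matrix ι ι ℝ) (z : ι → ℝ) :
    (-N).quad z = -N.quad z := by
  simp [quad, neg_mulVec]

lemma quad_eq_sum {ι : Type*} [Fintype ι] (N : Matrix ι ι ℝ) (z : ι → ℝ) :
    N.quad z = ∑ i, ∑ j, N i j * (z i * z j) := by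
  simp only [quad, dotProduct, mulVec, Finset.mul_sum]
  exact Finset.sum_congr rfl fun i _ => Finset.sum_congr rfl fun j _ => by ring

lemma quad_zero {ι : Type*} [Fintype ι] (N : Matrix ι ι ℝ) : N.quad 0 = 0 := by
  simp [quad]

lemma PosSemidef.quad_nonneg {ι : Type*} [Fintype ι] {N : Matrix ι ι ℝ} (h : N.PosSemidef)
    (z : ι → ℝ) : 0 ≤ N.quad z := by
  simpa [quad] using h.dotProduct_mulVec_nonneg z

lemma IsSymm.dotProduct_mulVec_comm {ι : Type*} [Fintype ι] {N : Matrix ι ι ℝ} (h : N.IsSymm)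
    (x y : ι → ℝ) : x ⬝ᵥ (N *ᵥ y) = y ⬝ᵥ (N *ᵥ x) := by
  rw [dotProduct_mulVec, dotProduct_comm, ← mulVec_transpose, h.eq]

end Matrix

/-- When `ẋ = A x + B u`, the right-hand side is the time derivative of `xᵀ P x`; all dissipation
arguments rest on this. -/
lemma lmiBlock_quad {n m : ℕ} (A : Matrix (Fin n) (Fin n) ℝ) (B : Matrix (Fin n) (Fin m) ℝ)
    {P : Matrix (Fin n) (Fin n) ℝ} (hP : P.IsSymm) (x : Fin n → ℝ) (u : Fin m → ℝ) :
    (lmiBlock A B P).quad (Sum.elim x u) = 2 * (x ⬝ᵥ (P *ᵥ (A *ᵥ x + B *ᵥ u))) := by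
  have h1 : x ⬝ᵥ ((Aᵀ * P) *ᵥ x) = x ⬝ᵥ (P *ᵥ (A *ᵥ x)) := by
    rw [← mulVec_mulVec, dotProduct_mulVec, vecMul_transpose, hP.dotProduct_mulVec_comm]
  have h2 : u ⬝ᵥ ((Bᵀ * P) *ᵥ x) = x ⬝ᵥ (P *ᵥ (B *ᵥ u)) := by
    rw [← mulVec_mulVec, dotProduct_mulVec, vecMul_transpose, hP.dotProduct_mulVec_comm]
  simp only [quad, lmiBlock, fromBlocks_mulVec, Sum.elim_comp_inl, Sum.elim_comp_inr,
    sumElim_dotProduct_sumElim, add_mulVec, dotProduct_add, mulVec_add, zero_mulVec,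
    dotProduct_zero, ← mulVec_mulVec] at h1 h2 ⊢
  linarith

lemma lmiBlock_isSymm {n m : ℕ} (A : Matrix (Fin n) (Fin n) ℝ) (B : Matrix (Fin n) (Fin m) ℝ)
    {P : Matrix (Fin n) (Fin n) ℝ} (hP : P.IsSymm) : (lmiBlock A B P).IsSymm := by
  refine IsSymm.fromBlocks ?_ ?_ (by simp [IsSymm])
  · simp [IsSymm, hP.eq, add_comm]
  · simp [hP.eq]

/-! ### Energy balance and storage functions. -/

/-- Product rule in integrated form for two primitives of integrable functions. -/
lemma integral_primitive_mul_primitive {f g F G : ℝ → ℝ} {a b : ℝ}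
    (hf : IntervalIntegrable f volume a b) (hg : IntervalIntegrable g volume a b)
    (hF : ∀ t ∈ Set.uIcc a b, F t = F a + ∫ τ in a..t, f τ)
    (hG : ∀ t ∈ Set.uIcc a b, G t = G a + ∫ τ in a..t, g τ) :
    IntervalIntegrable (fun t => f t * G t + F t * g t) volume a b ∧
      ∫ t in a..b, (f t * G t + F t * g t) = F b * G b - F a * G a := by
  -- `F` and `G` are controlled only on `[a, b]`, so integration by parts is applied to the explicit
  -- primitives, which are absolutely continuous with derivative `h` almost everywhere.
  have key : ∀ {h H : ℝ → ℝ}, IntervalIntegrable h volume a b →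
      AbsolutelyContinuousOnInterval (fun t => H a + ∫ τ in a..t, h τ) a b ∧
      ∀ᵐ t, t ∈ Set.uIcc a b → deriv (fun t => H a + ∫ τ in a..t, h τ) t = h t := by
    intro h H hh
    constructor
    · exact (LipschitzOnWith.absolutelyContinuousOnInterval (K := 0)
        (by intro x _ y _; simp : LipschitzOnWith 0 (fun _ : ℝ => H a) (Set.uIcc a b))).add
        (hh.absolutelyContinuousOnInterval_intervalIntegral (c := a) (by simp))
    · filter_upwards [hh.ae_hasDerivAt_integral] with t ht htm
      exact ((ht htm a (by simp)).const_add (H a)).deriv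
  obtain ⟨hF1, hF2⟩ := key (H := F) hf
  obtain ⟨hG1, hG2⟩ := key (H := G) hg
  have hFc : ContinuousOn F (Set.uIcc a b) := hF1.continuousOn.congr hF
  have hGc : ContinuousOn G (Set.uIcc a b) := hG1.continuousOn.congr hG
  refine ⟨(hf.mul_continuousOn hGc).add (hg.continuousOn_mul hFc), ?_⟩
  have := hF1.integral_deriv_mul_eq_sub hG1
  rw [← hF b (by simp), ← hG b (by simp)] at this
  simp only [intervalIntegral.integral_same, add_zero] at this
  rw [← this]
  apply intervalIntegral.integral_congr_ae
  filter_upwards [hF2, hG2] with t h1 h2 ht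
  have ht' := Set.uIoc_subset_uIcc ht
  rw [h1 ht', h2 ht', ← hF t ht', ← hG t ht']

/-- Energy balance `xᵀ P x |ₐᵇ = ∫ 2 xᵀ P ẋ` along a trajectory. -/
lemma SatisfiesLTI.integral_energy {n m : ℕ} {A : Matrix (Fin n) (Fin n) ℝ}
    {B : Matrix (Fin n) (Fin m) ℝ} {x : ℝ → Fin n → ℝ} {u : ℝ → Fin m → ℝ} {a b : ℝ}
    (h : SatisfiesLTI A B (Set.uIcc a b) x u) {P : Matrix (Fin n) (Fin n) ℝ} (hP : P.IsSymm) :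
    IntervalIntegrable (fun t => 2 * (x t ⬝ᵥ (P *ᵥ (A *ᵥ x t + B *ᵥ u t)))) volume a b ∧
      ∫ t in a..b, 2 * (x t ⬝ᵥ (P *ᵥ (A *ᵥ x t + B *ᵥ u t))) = P.quad (x b) - P.quad (x a) := by
  set f : ℝ → Fin n → ℝ := fun τ => A *ᵥ x τ + B *ᵥ u τ with hf
  have hint : ∀ t ∈ Set.uIcc a b, IntervalIntegrable f volume a t := fun t ht =>
    (h a (by simp) t ht).1
  have hcomp : ∀ i, ∀ t ∈ Set.uIcc a b, IntervalIntegrable (fun τ => f τ i) volume a t :=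
    fun i t ht => by
      have := hint t ht
      rw [intervalIntegrable_iff] at this ⊢
      exact this.eval i
  have hx : ∀ i, ∀ t ∈ Set.uIcc a b, x t i = x a i + ∫ τ in a..t, f τ i := by
    intro i t ht
    have h1 := (h a (by simp) t ht).2
    have h2 := (ContinuousLinearMap.proj (R := ℝ) (φ := fun _ : Fin n => ℝ)
      i).intervalIntegral_comp_comm (hint t ht)
    simp only [ContinuousLinearMap.proj_apply] at h2
    rw [h2, ← h1]
    simp
  -- The factor 2 is spent on symmetrising, so that each entry carries the derivative of the product
  -- `x i * x j`.
  have hpt : ∀ t, 2 * (x t ⬝ᵥ (P *ᵥ (A *ᵥ x t + B *ᵥ u t))) =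
      ∑ i, ∑ j, P i j * (f t i * x t j + x t i * f t j) := by
    intro t
    have h1 : ∀ v w : Fin n → ℝ, v ⬝ᵥ (P *ᵥ w) = ∑ i, ∑ j, P i j * (v i * w j) := by
      intro v w
      simp only [dotProduct, mulVec, Finset.mul_sum]
      exact Finset.sum_congr rfl fun i _ => Finset.sum_congr rfl fun j _ => by ring
    change 2 * (x t ⬝ᵥ (P *ᵥ f t)) = _
    rw [two_mul]
    nth_rw 1 [hP.dotProduct_mulVec_comm]
    simp only [h1, mul_add, Finset.sum_add_distrib]
  have hij := fun i j => integral_primitive_mul_primitive (hcomp i b (by simp))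
    (hcomp j b (by simp)) (hx i) (hx j)
  have hI : ∀ i j, IntervalIntegrable (fun t => P i j * (f t i * x t j + x t i * f t j))
      volume a b := fun i j => (hij i j).1.const_mul _
  have hI' : ∀ i, IntervalIntegrable (fun t => ∑ j, P i j * (f t i * x t j + x t i * f t j))
      volume a b := fun i => by
    have := IntervalIntegrable.sum Finset.univ (fun j _ => hI i j)
    simpa [Finset.sum_fn] using this
  constructor
  · simp only [hpt]
    have := IntervalIntegrable.sum Finset.univ (fun i _ => hI' i)
    simpa [Finset.sum_fn] using this
  · simp only [hpt]
    rw [intervalIntegral.integral_finsetSum (fun i _ => hI' i)]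
    simp only [quad_eq_sum]
    rw [← Finset.sum_sub_distrib]
    refine Finset.sum_congr rfl fun i _ => ?_
    rw [intervalIntegral.integral_finsetSum (fun j _ => hI i j), ← Finset.sum_sub_distrib]
    refine Finset.sum_congr rfl fun j _ => ?_
    rw [intervalIntegral.integral_const_mul, (hij i j).2]
    ring

lemma SatisfiesLTI.mono {n m : ℕ} {A : Matrix (Fin n) (Fin n) ℝ}
    {B : Matrix (Fin n) (Fin m) ℝ} {x : ℝ → Fin n → ℝ} {u : ℝ → Fin m → ℝ} {J K : Set ℝ}
    (h : SatisfiesLTI A B K x u) (hJ : J ⊆ K) : SatisfiesLTI A B J x u :=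
  fun s hs t ht => h s (hJ hs) t (hJ ht)

/-- A solution of the linear matrix inequality is a storage function. -/
lemma SatisfiesLTI.integral_quad_le {n m : ℕ} {A : Matrix (Fin n) (Fin n) ℝ}
    {B : Matrix (Fin n) (Fin m) ℝ} {x : ℝ → Fin n → ℝ} {u : ℝ → Fin m → ℝ} {a b : ℝ}
    (hab : a ≤ b) (h : SatisfiesLTI A B (Set.Icc a b) x u) {P : Matrix (Fin n) (Fin n) ℝ}
    (hP : P.IsSymm) {M : Matrix (Fin n ⊕ Fin m) (Fin n ⊕ Fin m) ℝ}
    (hM : (-(M + lmiBlock A B P)).PosSemidef)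
    (hint : IntervalIntegrable (fun t => M.quad (Sum.elim (x t) (u t))) volume a b) :
    ∫ t in a..b, M.quad (Sum.elim (x t) (u t)) ≤ P.quad (x a) - P.quad (x b) := by
  rw [← Set.uIcc_of_le hab] at h
  obtain ⟨h1, h2⟩ := h.integral_energy hP
  rw [← neg_sub, ← h2, ← intervalIntegral.integral_neg]
  apply intervalIntegral.integral_mono_on hab hint h1.neg
  intro t _
  have := hM.quad_nonneg (Sum.elim (x t) (u t))
  rw [quad_neg, quad_add_left, lmiBlock_quad A B hP] at this
  simp only [Pi.neg_apply]
  linarith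

lemma Matrix.integrable_quad {ι : Type*} [Fintype ι] (N : Matrix ι ι ℝ) {z : ℝ → ι → ℝ}
    (hz : ∀ i, MemLp (fun t => z t i) 2 volume) : Integrable (fun t => N.quad (z t)) := by
  simp only [quad_eq_sum]
  exact integrable_finsetSum _ fun i _ => integrable_finsetSum _ fun j _ =>
    ((hz i).integrable_mul (hz j)).const_mul _

lemma memLp_sumElim {n m : ℕ} {x : ℝ → Fin n → ℝ} {u : ℝ → Fin m → ℝ}
    (hx : MemLp x 2 volume) (hu : MemLp u 2 volume) (i : Fin n ⊕ Fin m) :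
    MemLp (fun t => Sum.elim (x t) (u t) i) 2 volume := by
  rcases i with i | i
  · exact hx.eval i
  · exact hu.eval i

lemma quad_sumElim_zero_nonpos {n m : ℕ} {A : Matrix (Fin n) (Fin n) ℝ}
    {B : Matrix (Fin n) (Fin m) ℝ} {P : Matrix (Fin n) (Fin n) ℝ} (hP : P.IsSymm)
    {M : Matrix (Fin n ⊕ Fin m) (Fin n ⊕ Fin m) ℝ}
    (hM : (-(M + lmiBlock A B P)).PosSemidef) (u : Fin m → ℝ) :
    M.quad (Sum.elim 0 u) ≤ 0 := by
  have := hM.quad_nonneg (Sum.elim 0 u)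
  rw [quad_neg, quad_add_left, lmiBlock_quad A B hP, zero_dotProduct] at this
  linarith

/-- The linear matrix inequality implies the integral quadratic constraint. -/
lemma integral_quad_nonpos {n m : ℕ} {A : Matrix (Fin n) (Fin n) ℝ}
    {B : Matrix (Fin n) (Fin m) ℝ} {P : Matrix (Fin n) (Fin n) ℝ} (hP : P.IsSymm)
    {M : Matrix (Fin n ⊕ Fin m) (Fin n ⊕ Fin m) ℝ}
    (hM : (-(M + lmiBlock A B P)).PosSemidef) {x : ℝ → Fin n → ℝ} {u : ℝ → Fin m → ℝ}
    (hx : MemLp x 2 volume) (hu : MemLp u 2 volume) (h : SatisfiesLTI A B Set.univ x u) :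
    ∫ t, M.quad (Sum.elim (x t) (u t)) ≤ 0 := by
  have hMi := M.integrable_quad (memLp_sumElim hx hu)
  have hLi := (lmiBlock A B P).integrable_quad (memLp_sumElim hx hu)
  have hPi : Integrable (fun t => P.quad (x t)) := P.integrable_quad fun i => hx.eval i
  have hneg := Filter.tendsto_neg_atTop_atBot (G := ℝ)
  have hid : Filter.Tendsto (fun t : ℝ => t) Filter.atTop Filter.atTop := Filter.tendsto_id
  have hle : ∀ T : ℝ, 0 ≤ T → ∫ t in (-T)..T, M.quad (Sum.elim (x t) (u t)) ≤
      P.quad (x (-T)) - P.quad (x T) := fun T hT =>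
    (h.mono (Set.subset_univ _)).integral_quad_le (by linarith) hP hM hMi.intervalIntegrable
  have hE : ∀ T : ℝ, ∫ t in (-T)..T, (lmiBlock A B P).quad (Sum.elim (x t) (u t)) =
      P.quad (x T) - P.quad (x (-T)) := fun T => by
    simp only [lmiBlock_quad A B hP]
    exact ((h.mono (Set.subset_univ _)).integral_energy hP).2
  have hlim := intervalIntegral_tendsto_integral hLi hneg hid
  simp only [hE] at hlim
  -- Pointwise decay of `x` is not assumed. The boundary term converges because it is the integral
  -- of an integrable function over `[-T, T]`; it is also integrable in `T`, so its limit can only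
  -- be zero.
  have hzero := IntegrableAtFilter.eq_zero_of_tendsto
    ((hPi.sub hPi.comp_neg).integrableAtFilter Filter.atTop) (fun s hs => by
      obtain ⟨b, hb⟩ := Filter.mem_atTop_sets.1 hs
      rw [← top_le_iff, ← Real.volume_Ici (a := b)]
      exact measure_mono hb) hlim
  rw [hzero] at hlim
  have hlim' : Filter.Tendsto (fun T => P.quad (x (-T)) - P.quad (x T)) Filter.atTop (nhds 0) := by
    simpa using hlim.neg
  refine le_of_tendsto_of_tendsto (intervalIntegral_tendsto_integral hMi hneg hid) hlim' ?_
  filter_upwards [Filter.eventually_ge_atTop 0] with T hT using hle T hT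

/-! ### Complexification and perturbation of linear systems. -/

/-- The value of the Hermitian form `z* N z` of a real symmetric matrix at a complex vector. -/
def Matrix.hermQuad {ι : Type*} [Fintype ι] (N : Matrix ι ι ℝ) (z : ι → ℂ) : ℝ :=
  N.quad (fun i => (z i).re) + N.quad (fun i => (z i).im)

namespace Matrix

lemma toComplex_mulVec_re {ι κ : Type*} [Fintype κ] (N : Matrix ι κ ℝ) (z : κ → ℂ) (i : ι) :
    ((N.toComplex *ᵥ z) i).re = (N *ᵥ fun j => (z j).re) i := by
  simp [mulVec, dotProduct, toComplex]

lemma toComplex_mulVec_im {ι κ : Type*} [Fintype κ] (N : Matrix ι κ ℝ) (z : κ → ℂ) (i : ι) :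
    ((N.toComplex *ᵥ z) i).im = (N *ᵥ fun j => (z j).im) i := by
  simp [mulVec, dotProduct, toComplex]

lemma toComplex_mul {ι κ μ : Type*} [Fintype κ] (N : Matrix ι κ ℝ) (N' : Matrix κ μ ℝ) :
    (N * N').toComplex = N.toComplex * N'.toComplex := by
  ext i j
  simp [toComplex, mul_apply]

lemma toComplex_conjTranspose {ι κ : Type*} (N : Matrix ι κ ℝ) :
    N.toComplexᴴ = Nᵀ.toComplex := by
  ext i j
  simp [toComplex]

lemma IsSymm.star_dotProduct_toComplex_mulVec {ι : Type*} [Fintype ι] {N : Matrix ι ι ℝ}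
    (hN : N.IsSymm) (z : ι → ℂ) :
    star z ⬝ᵥ (N.toComplex *ᵥ z) = (N.hermQuad z : ℂ) := by
  apply Complex.ext
  · simp [dotProduct, hermQuad, quad, toComplex_mulVec_re, toComplex_mulVec_im,
      Finset.sum_add_distrib]
  · have := hN.dotProduct_mulVec_comm (fun i => (z i).re) (fun i => (z i).im)
    simp only [dotProduct] at this
    simp [dotProduct, toComplex_mulVec_re, toComplex_mulVec_im, Finset.sum_add_distrib, this]

lemma continuous_quad {ι : Type*} [Fintype ι] (N : Matrix ι ι ℝ) : Continuous N.quad := by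
  unfold quad
  fun_prop

lemma continuous_hermQuad {ι : Type*} [Fintype ι] (N : Matrix ι ι ℝ) :
    Continuous N.hermQuad := by
  unfold hermQuad
  exact (N.continuous_quad.comp (by fun_prop)).add (N.continuous_quad.comp (by fun_prop))

lemma not_hasEigenvalue_toLin'_iff {ι : Type*} [Fintype ι] [DecidableEq ι] (N : Matrix ι ι ℂ)
    (μ : ℂ) : ¬ Module.End.HasEigenvalue (toLin' N) μ ↔ IsUnit (μ • (1 : Matrix ι ι ℂ) - N) := by
  rw [Module.End.hasEigenvalue_iff_mem_spectrum, spectrum_toLin', spectrum.mem_iff, not_not,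
    Algebra.algebraMap_eq_smul_one]

/-- A matrix with trivial left kernel has a right inverse. -/
lemma exists_right_inverse_of_vecMul {ι κ : Type*} [Fintype ι] [DecidableEq ι] [Fintype κ]
    (G : Matrix ι κ ℂ) (hG : ∀ y, y ᵥ* G = 0 → y = 0) : ∃ R : Matrix κ ι ℂ, G * R = 1 := by
  have h : IsUnit (G * Gᴴ) := by
    rw [← vecMul_injective_iff_isUnit]
    intro y y' hyy
    have : (y - y') ᵥ* (G * Gᴴ) = 0 := by
      rw [sub_vecMul]; exact sub_eq_zero.2 hyy
    exact sub_eq_zero.1 (hG _ ((vecMul_self_mul_conjTranspose_eq_zero G _).1 this))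
  refine ⟨Gᴴ * (G * Gᴴ)⁻¹, ?_⟩
  rw [← Matrix.mul_assoc, mul_nonsing_inv _ ((isUnit_iff_isUnit_det _).1 h)]

/-- Solutions of a perturbed linear system depend continuously on the perturbation. -/
lemma tendsto_inv_sub_smul_mulVec {ι : Type*} [Fintype ι] [DecidableEq ι] {c : ℂ} (hc : c ≠ 0)
    (N : Matrix ι ι ℂ) {w : ℝ → ι → ℂ} {w₀ : ι → ℂ} (hw : Filter.Tendsto w (nhds 0) (nhds w₀)) :
    (∀ᶠ ε : ℝ in nhds 0, IsUnit (c • (1 : Matrix ι ι ℂ) - (ε : ℂ) • N)) ∧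
    Filter.Tendsto (fun ε : ℝ => (c • (1 : Matrix ι ι ℂ) - (ε : ℂ) • N)⁻¹ *ᵥ w ε) (nhds 0)
      (nhds (c⁻¹ • w₀)) := by
  have hcont : Continuous fun ε : ℝ => c • (1 : Matrix ι ι ℂ) - (ε : ℂ) • N := by fun_prop
  have hdet : (c • (1 : Matrix ι ι ℂ) - ((0 : ℝ) : ℂ) • N).det ≠ 0 := by
    simp [hc]
  constructor
  · have := (hcont.matrix_det.tendsto 0).eventually_ne hdet
    filter_upwards [this] with ε hε
    rw [isUnit_iff_isUnit_det]
    exact hε.isUnit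
  · have h1 : ContinuousAt Inv.inv (c • (1 : Matrix ι ι ℂ) - ((0 : ℝ) : ℂ) • N) := by
      apply continuousAt_matrix_inv
      rw [Ring.inverse_eq_inv']
      exact continuousAt_inv₀ hdet
    have h2 := h1.tendsto.comp (hcont.tendsto 0)
    have h3 : (c • (1 : Matrix ι ι ℂ) - ((0 : ℝ) : ℂ) • N)⁻¹ = c⁻¹ • 1 := by
      apply inv_eq_left_inv
      simp [smul_smul, hc]
    rw [h3] at h2
    have h4 := (Continuous.matrix_mulVec continuous_fst continuous_snd).tendsto
      ((c⁻¹ • (1 : Matrix ι ι ℂ)), w₀) |>.comp (h2.prodMk_nhds hw)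
    simpa [Function.comp_def, smul_mulVec] using h4

end Matrix

/-! ### Consequences of controllability. -/

/-- Bounds on storage functions that come from steering the origin to `v` and back. -/
lemma Controllable.exists_quad_bound {n m : ℕ} {A : Matrix (Fin n) (Fin n) ℝ}
    {B : Matrix (Fin n) (Fin m) ℝ} (hAB : Controllable A B) (v : Fin n → ℝ) :
    ∃ C : ℝ, 0 ≤ C ∧ ∀ (M : Matrix (Fin n ⊕ Fin m) (Fin n ⊕ Fin m) ℝ)
      (P : Matrix (Fin n) (Fin n) ℝ), P.IsSymm → (-(M + lmiBlock A B P)).PosSemidef →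
        |P.quad v| ≤ C * ∑ i, ∑ j, |M i j| := by
  have key : ∀ x₀ x₁ : Fin n → ℝ, ∃ C : ℝ, 0 ≤ C ∧
      ∀ (M : Matrix (Fin n ⊕ Fin m) (Fin n ⊕ Fin m) ℝ)
      (P : Matrix (Fin n) (Fin n) ℝ), P.IsSymm → (-(M + lmiBlock A B P)).PosSemidef →
        P.quad x₁ - P.quad x₀ ≤ C * ∑ i, ∑ j, |M i j| := by
    intro x₀ x₁
    obtain ⟨T, hT, x, u, hx, hu, h, h0, h1⟩ := hAB x₀ x₁
    set z : ℝ → Fin n ⊕ Fin m → ℝ := fun t => Sum.elim (x t) (u t) with hz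
    have hzc : ∀ i, ContinuousOn (fun t => z t i) (Set.uIcc 0 T) := by
      rw [Set.uIcc_of_le hT]
      rintro (i | i)
      · exact (continuous_apply i).comp_continuousOn hx
      · exact (continuous_apply i).comp_continuousOn hu
    have hI : ∀ i j, IntervalIntegrable (fun t => z t i * z t j) volume 0 T := fun i j =>
      ((hzc i).mul (hzc j)).intervalIntegrable
    -- The cost of the steering trajectory is linear in `M`, with these second moments as
    -- coefficients. They depend on the trajectory alone, hence the bound is uniform in `M` and `P`.
    set c : Fin n ⊕ Fin m → Fin n ⊕ Fin m → ℝ := fun i j => |∫ t in (0 : ℝ)..T, z t i * z t j|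
    have hc0 : ∀ i j, 0 ≤ c i j := fun i j => abs_nonneg _
    have hcle : ∀ i j, c i j ≤ ∑ i, ∑ j, c i j := fun i j =>
      (Finset.single_le_sum (f := fun j => c i j) (fun j _ => hc0 i j) (Finset.mem_univ j)).trans
        (Finset.single_le_sum (f := fun i => ∑ j, c i j)
          (fun i _ => Finset.sum_nonneg fun j _ => hc0 i j) (Finset.mem_univ i))
    refine ⟨∑ i, ∑ j, c i j, Finset.sum_nonneg fun i _ => Finset.sum_nonneg fun j _ => hc0 i j,
      fun M P hP hM => ?_⟩
    have hI1 : ∀ i j, IntervalIntegrable (fun t => M i j * (z t i * z t j)) volume 0 T :=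
      fun i j => (hI i j).const_mul _
    have hI2 : ∀ i, IntervalIntegrable (fun t => ∑ j, M i j * (z t i * z t j)) volume 0 T :=
      fun i => by
        simpa [Finset.sum_fn] using IntervalIntegrable.sum Finset.univ (fun j _ => hI1 i j)
    have hI3 : IntervalIntegrable (fun t => M.quad (z t)) volume 0 T := by
      simp only [quad_eq_sum]
      simpa [Finset.sum_fn] using IntervalIntegrable.sum Finset.univ (fun i _ => hI2 i)
    have hle := h.integral_quad_le hT hP hM hI3
    have hval : ∫ t in (0 : ℝ)..T, M.quad (z t) =
        ∑ i, ∑ j, M i j * ∫ t in (0 : ℝ)..T, z t i * z t j := by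
      simp only [quad_eq_sum]
      rw [intervalIntegral.integral_finsetSum (fun i _ => hI2 i)]
      refine Finset.sum_congr rfl fun i _ => ?_
      rw [intervalIntegral.integral_finsetSum (fun j _ => hI1 i j)]
      exact Finset.sum_congr rfl fun j _ => intervalIntegral.integral_const_mul _ _
    have hge : -((∑ i, ∑ j, c i j) * ∑ i, ∑ j, |M i j|) ≤ ∫ t in (0 : ℝ)..T, M.quad (z t) := by
      rw [hval, Finset.mul_sum, ← Finset.sum_neg_distrib]
      refine Finset.sum_le_sum fun i _ => ?_
      rw [Finset.mul_sum, ← Finset.sum_neg_distrib]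
      refine Finset.sum_le_sum fun j _ => ?_
      refine (neg_le_neg ?_).trans (neg_abs_le _)
      rw [abs_mul, mul_comm]
      exact mul_le_mul_of_nonneg_right (hcle i j) (abs_nonneg _)
    rw [h0, h1] at hle
    linarith
  -- As `xᵀ P x` vanishes at the origin, steering from 0 to `v` bounds it above at `v`, and steering
  -- back bounds it below.
  obtain ⟨C₁, hC₁, h₁⟩ := key 0 v
  obtain ⟨C₂, hC₂, h₂⟩ := key v 0
  refine ⟨C₁ + C₂, add_nonneg hC₁ hC₂, fun M P hP hM => ?_⟩
  have hS : 0 ≤ ∑ i, ∑ j, |M i j| :=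
    Finset.sum_nonneg fun i _ => Finset.sum_nonneg fun j _ => abs_nonneg _
  have h1 := h₁ M P hP hM
  have h2 := h₂ M P hP hM
  rw [quad_zero] at h1 h2
  rw [abs_le]
  constructor <;> nlinarith [mul_nonneg hC₁ hS, mul_nonneg hC₂ hS]

/-- The Hautus test: for a controllable pair, `[μ - A, -B]` with `μ` purely imaginary has trivial
left kernel. -/
lemma Controllable.vecMul_eq_zero {n m : ℕ} {A : Matrix (Fin n) (Fin n) ℝ}
    {B : Matrix (Fin n) (Fin m) ℝ} (hAB : Controllable A B) {ω : ℝ} {y : Fin n → ℂ}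
    (hA : y ᵥ* A.toComplex = (Complex.I * (ω : ℂ)) • y) (hB : y ᵥ* B.toComplex = 0) : y = 0 := by
  set p : Fin n → ℝ := fun i => (y i).re with hp
  set q : Fin n → ℝ := fun i => (y i).im with hq
  have hre : ∀ {k : ℕ} (N : Matrix (Fin n) (Fin k) ℝ) j,
      ((y ᵥ* N.toComplex) j).re = (p ᵥ* N) j := fun N j => by
    simp [vecMul, dotProduct, toComplex, hp]
  have him : ∀ {k : ℕ} (N : Matrix (Fin n) (Fin k) ℝ) j,
      ((y ᵥ* N.toComplex) j).im = (q ᵥ* N) j := fun N j => by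
    simp [vecMul, dotProduct, toComplex, hq]
  have hpA : p ᵥ* A = -ω • q := by
    ext j; rw [← hre, hA]; simp [hq]
  have hqA : q ᵥ* A = ω • p := by
    ext j; rw [← him, hA]; simp [hp]
  have hpB : p ᵥ* B = 0 := by
    ext j; rw [← hre, hB]; simp
  have hqB : q ᵥ* B = 0 := by
    ext j; rw [← him, hB]; simp
  -- This is the real part of `y y*`. Its block `lmiBlock A B P` vanishes, so `P` solves the
  -- inequality for `M = 0`; the bound on storage functions then forces `vᵀ P v = 0` for every `v`.
  set P : Matrix (Fin n) (Fin n) ℝ := vecMulVec p p + vecMulVec q q with hPdef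
  have hP : P.IsSymm := by
    ext i j; simp [hPdef, vecMulVec_apply, mul_comm]
  have hPA : P * A = -ω • vecMulVec p q + ω • vecMulVec q p := by
    rw [hPdef, add_mul, vecMulVec_mul, vecMulVec_mul, hpA, hqA, vecMulVec_smul, vecMulVec_smul]
  have hPB : P * B = 0 := by
    rw [hPdef, Matrix.add_mul, vecMulVec_mul, vecMulVec_mul, hpB, hqB]
    ext i j; simp [vecMulVec_apply]
  have hAP : Aᵀ * P = -(P * A) := by
    have : Aᵀ * P = (P * A)ᵀ := by rw [transpose_mul, hP.eq]
    rw [this, hPA]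
    ext i j
    simp [vecMulVec_apply]
    ring
  have hBP : Bᵀ * P = 0 := by
    have : Bᵀ * P = (P * B)ᵀ := by rw [transpose_mul, hP.eq]
    rw [this, hPB, transpose_zero]
  have hL : lmiBlock A B P = 0 := by
    rw [lmiBlock, hAP, hPB, hBP, neg_add_cancel, fromBlocks_zero]
  have hquad : ∀ v, P.quad v = (v ⬝ᵥ p) ^ 2 + (v ⬝ᵥ q) ^ 2 := fun v => by
    rw [hPdef, quad_add_left]
    simp only [quad, vecMulVec_mulVec, dotProduct_smul, MulOpposite.smul_eq_mul_unop,
      MulOpposite.unop_op, dotProduct_comm p v, dotProduct_comm q v]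
    ring
  have hz : ∀ v, (v ⬝ᵥ p) ^ 2 + (v ⬝ᵥ q) ^ 2 = 0 := fun v => by
    obtain ⟨C, -, h⟩ := hAB.exists_quad_bound v
    have := h 0 P hP (by rw [hL]; simpa using PosSemidef.zero)
    simp at this
    rw [← hquad, this]
  have hp0 : p = 0 := dotProduct_self_eq_zero.1 (pow_eq_zero_iff two_ne_zero |>.1
    (by nlinarith [hz p, sq_nonneg (p ⬝ᵥ p), sq_nonneg (p ⬝ᵥ q)]))
  have hq0 : q = 0 := dotProduct_self_eq_zero.1 (pow_eq_zero_iff two_ne_zero |>.1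
    (by nlinarith [hz q, sq_nonneg (q ⬝ᵥ p), sq_nonneg (q ⬝ᵥ q)]))
  ext i
  exact Complex.ext (congrFun hp0 i) (congrFun hq0 i)

/-! ### From the frequency-domain inequality to all complex sinusoids. -/

section Frequency

variable {n m : ℕ} {A : Matrix (Fin n) (Fin n) ℝ} {B : Matrix (Fin n) (Fin m) ℝ}
  {M : Matrix (Fin n ⊕ Fin m) (Fin n ⊕ Fin m) ℝ}

lemma frequencyMatrix_mulVec (ω : ℝ) (u : Fin m → ℂ) :
    frequencyMatrix A B ω *ᵥ u = Sum.elim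
      (((Complex.I * (ω : ℂ)) • (1 : Matrix (Fin n) (Fin n) ℂ) - A.toComplex)⁻¹ *ᵥ
        (B.toComplex *ᵥ u)) u := by
  rw [frequencyMatrix, fromRows_mulVec, one_mulVec, mulVec_mulVec]

lemma frequencyMatrix_mulVec_eq {ω : ℝ}
    (hω : IsUnit ((Complex.I * (ω : ℂ)) • (1 : Matrix (Fin n) (Fin n) ℂ) - A.toComplex))
    {x : Fin n → ℂ} {u : Fin m → ℂ}
    (h : (Complex.I * (ω : ℂ)) • x = A.toComplex *ᵥ x + B.toComplex *ᵥ u) :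
    frequencyMatrix A B ω *ᵥ u = Sum.elim x u := by
  have : B.toComplex *ᵥ u =
      ((Complex.I * (ω : ℂ)) • (1 : Matrix (Fin n) (Fin n) ℂ) - A.toComplex) *ᵥ x := by
    rw [sub_mulVec, smul_mulVec, one_mulVec, h, add_sub_cancel_left]
  rw [frequencyMatrix_mulVec, this, mulVec_mulVec,
    nonsing_inv_mul _ ((isUnit_iff_isUnit_det _).1 hω), one_mulVec]

lemma star_dotProduct_frequency (hM : M.IsSymm) (ω : ℝ) (u : Fin m → ℂ) :
    star u ⬝ᵥ (((frequencyMatrix A B ω)ᴴ * M.toComplex * frequencyMatrix A B ω) *ᵥ u) =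
      (M.hermQuad (frequencyMatrix A B ω *ᵥ u) : ℂ) := by
  rw [← hM.star_dotProduct_toComplex_mulVec, star_mulVec, ← dotProduct_mulVec, mulVec_mulVec,
    mulVec_mulVec, Matrix.mul_assoc]

lemma posSemidef_neg_frequency_iff (hM : M.IsSymm) (ω : ℝ) :
    (-((frequencyMatrix A B ω)ᴴ * M.toComplex * frequencyMatrix A B ω)).PosSemidef ↔
      ∀ u, M.hermQuad (frequencyMatrix A B ω *ᵥ u) ≤ 0 := by
  have hH : (M.toComplex).IsHermitian := by
    rw [IsHermitian, toComplex_conjTranspose, hM.eq]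
  rw [posSemidef_iff_dotProduct_mulVec, and_iff_right
    ((isHermitian_conjTranspose_mul_mul (frequencyMatrix A B ω) hH).neg)]
  refine forall_congr' fun u => ?_
  rw [neg_mulVec, dotProduct_neg, star_dotProduct_frequency hM, ← Complex.ofReal_neg,
    Complex.zero_le_real, neg_nonneg]

/-- Perturbing the frequency: the frequency inequality away from the spectrum of `A` extends to
all complex sinusoids of a controllable system. -/
lemma hermQuad_nonpos_of_frequency (hAB : Controllable A B)
    (h : ∀ ω : ℝ, IsUnit ((Complex.I * (ω : ℂ)) • (1 : Matrix (Fin n) (Fin n) ℂ) - A.toComplex) →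
      ∀ u, M.hermQuad (frequencyMatrix A B ω *ᵥ u) ≤ 0)
    {x : Fin n → ℂ} {u : Fin m → ℂ} {ω : ℝ}
    (hxu : (Complex.I * (ω : ℂ)) • x = A.toComplex *ᵥ x + B.toComplex *ᵥ u) :
    M.hermQuad (Sum.elim x u) ≤ 0 := by
  set D : Matrix (Fin n) (Fin n) ℂ :=
    (Complex.I * (ω : ℂ)) • (1 : Matrix (Fin n) (Fin n) ℂ) - A.toComplex with hD
  obtain ⟨R, hR⟩ := exists_right_inverse_of_vecMul (fromCols D (-B.toComplex)) fun y hy => by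
    rw [vecMul_fromCols] at hy
    have h1 : y ᵥ* D = 0 := by
      ext j; exact congrFun hy (Sum.inl j)
    have h2 : y ᵥ* (-B.toComplex) = 0 := by
      ext j; exact congrFun hy (Sum.inr j)
    refine hAB.vecMul_eq_zero (ω := ω) ?_ (by simpa [vecMul_neg] using h2)
    rw [hD, vecMul_sub, vecMul_smul, vecMul_one, sub_eq_zero] at h1
    exact h1.symm
  obtain ⟨R₁, R₂, rfl⟩ : ∃ R₁ R₂, R = fromRows R₁ R₂ := ⟨_, _, (fromRows_toRows R).symm⟩
  rw [fromCols_mul_fromRows, Matrix.neg_mul] at hR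
  obtain ⟨hU, hlim⟩ := tendsto_inv_sub_smul_mulVec (c := 1) one_ne_zero ((-Complex.I) • R₁)
    (w := fun _ => x) tendsto_const_nhds
  -- With `D R₁ - B R₂ = 1`, the choice `x' + iε R₁ x' = x` and `u' = u - iε R₂ x'` solves the
  -- equation exactly at frequency `ω + ε`, and it tends to `(x, u)` as `ε → 0`.
  set x' : ℝ → Fin n → ℂ := fun ε => ((1 : ℂ) • (1 : Matrix (Fin n) (Fin n) ℂ) -
    (ε : ℂ) • ((-Complex.I) • R₁))⁻¹ *ᵥ x with hx'
  set u' : ℝ → Fin m → ℂ := fun ε => u - (Complex.I * ε) • (R₂ *ᵥ x' ε) with hu'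
  rw [inv_one, one_smul] at hlim
  have hulim : Filter.Tendsto u' (nhds 0) (nhds u) := by
    have h1 : Filter.Tendsto (fun ε : ℝ => Complex.I * (ε : ℂ)) (nhds 0) (nhds 0) := by
      have : Continuous fun ε : ℝ => Complex.I * (ε : ℂ) := by fun_prop
      simpa using this.tendsto 0
    have hR₂ : Continuous fun v => R₂ *ᵥ v := by fun_prop
    have h2 := (hR₂.tendsto x).comp hlim
    simpa [hu', Function.comp_def] using tendsto_const_nhds.sub (h1.smul h2)
  have hzlim : Filter.Tendsto (fun ε => Sum.elim (x' ε) (u' ε)) (nhds 0) (nhds (Sum.elim x u)) := by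
    rw [tendsto_pi_nhds] at hlim hulim ⊢
    rintro (i | i)
    · exact hlim i
    · exact hulim i
  -- There are finitely many eigenvalues, so all small `ε ≠ 0` give regular frequencies, even if
  -- `iω` itself is an eigenvalue.
  have hspec : ∀ᶠ ε : ℝ in nhdsWithin 0 {0}ᶜ, IsUnit ((Complex.I * ((ω + ε : ℝ) : ℂ)) •
      (1 : Matrix (Fin n) (Fin n) ℂ) - A.toComplex) := by
    have hfin : {ε : ℝ | Module.End.HasEigenvalue (toLin' A.toComplex)
        (Complex.I * ((ω + ε : ℝ) : ℂ))}.Finite := by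
      refine (Module.End.finite_hasEigenvalue (toLin' A.toComplex)).preimage (f := fun ε : ℝ =>
        Complex.I * ((ω + ε : ℝ) : ℂ)) (Function.Injective.injOn fun a b hab => ?_)
      simpa using hab
    have := (hfin.subset (Set.sdiff_subset (t := {0}))).isClosed.isOpen_compl.mem_nhds
      (x := (0 : ℝ)) (by simp)
    filter_upwards [nhdsWithin_le_nhds this, self_mem_nhdsWithin] with ε h1 h2
    rw [← not_hasEigenvalue_toLin'_iff]
    exact fun h3 => h1 ⟨h3, h2⟩
  refine le_of_tendsto ((M.continuous_hermQuad.tendsto _).comp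
    (hzlim.mono_left (nhdsWithin_le_nhds (s := {0}ᶜ)))) ?_
  filter_upwards [hspec, nhdsWithin_le_nhds hU] with ε h1 h2
  have hx1 : x' ε + (Complex.I * ε) • (R₁ *ᵥ x' ε) = x := by
    have : ((1 : ℂ) • (1 : Matrix (Fin n) (Fin n) ℂ) - (ε : ℂ) • ((-Complex.I) • R₁)) *ᵥ x' ε
        = x := by
      rw [hx', mulVec_mulVec, mul_nonsing_inv _ ((isUnit_iff_isUnit_det _).1 h2), one_mulVec]
    rw [← this, sub_mulVec, one_smul, one_mulVec, smul_smul, smul_mulVec, sub_eq_add_neg,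
      ← neg_smul]
    simp [mul_comm]
  have hsol : (Complex.I * ((ω + ε : ℝ) : ℂ)) • x' ε =
      A.toComplex *ᵥ x' ε + B.toComplex *ᵥ u' ε := by
    have e1 : D *ᵥ x = B.toComplex *ᵥ u := by
      rw [hD, sub_mulVec, smul_mulVec, one_mulVec, hxu, add_sub_cancel_left]
    have e2 : D *ᵥ (R₁ *ᵥ x' ε) - B.toComplex *ᵥ (R₂ *ᵥ x' ε) = x' ε := by
      rw [mulVec_mulVec (x' ε) D, mulVec_mulVec (x' ε) B.toComplex, ← sub_mulVec, sub_eq_add_neg,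
        hR, one_mulVec]
    have e3 : D *ᵥ x' ε = (Complex.I * (ω : ℂ)) • x' ε - A.toComplex *ᵥ x' ε := by
      rw [hD, sub_mulVec, smul_mulVec, one_mulVec]
    have e4 : D *ᵥ x' ε + (Complex.I * ε) • (D *ᵥ (R₁ *ᵥ x' ε)) = D *ᵥ x := by
      rw [← mulVec_smul, ← mulVec_add, hx1]
    have e5 : B.toComplex *ᵥ u' ε =
        B.toComplex *ᵥ u - (Complex.I * ε) • (B.toComplex *ᵥ (R₂ *ᵥ x' ε)) := by
      rw [hu', mulVec_sub, mulVec_smul]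
    rw [e5, ← e1, ← e4, e3, sub_eq_iff_eq_add.1 e2]
    push_cast
    module
  rw [Function.comp_apply, ← frequencyMatrix_mulVec_eq h1 hsol]
  exact h _ h1 _

/-- Letting the frequency tend to infinity. -/
lemma hermQuad_zero_nonpos_of_frequency
    (h : ∀ ω : ℝ, IsUnit ((Complex.I * (ω : ℂ)) • (1 : Matrix (Fin n) (Fin n) ℂ) - A.toComplex) →
      ∀ u, M.hermQuad (frequencyMatrix A B ω *ᵥ u) ≤ 0) (u : Fin m → ℂ) :
    M.hermQuad (Sum.elim 0 u) ≤ 0 := by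
  have hw : Filter.Tendsto (fun ε : ℝ => (ε : ℂ) • (B.toComplex *ᵥ u)) (nhds 0) (nhds 0) := by
    have : Continuous fun ε : ℝ => (ε : ℂ) • (B.toComplex *ᵥ u) := by fun_prop
    simpa using this.tendsto 0
  -- With `ε = 1/ω`, one has `(iω - A)⁻¹ B u = (i - ε A)⁻¹ (ε B u)`, which tends to zero with `ε`.
  obtain ⟨hU, hlim⟩ := tendsto_inv_sub_smul_mulVec Complex.I_ne_zero A.toComplex hw
  set x' : ℝ → Fin n → ℂ := fun ε => (Complex.I • (1 : Matrix (Fin n) (Fin n) ℂ) -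
    (ε : ℂ) • A.toComplex)⁻¹ *ᵥ ((ε : ℂ) • (B.toComplex *ᵥ u)) with hx'
  rw [smul_zero] at hlim
  have hzlim : Filter.Tendsto (fun ε => Sum.elim (x' ε) u) (nhds 0) (nhds (Sum.elim 0 u)) := by
    rw [tendsto_pi_nhds] at hlim ⊢
    rintro (i | i)
    · exact hlim i
    · exact tendsto_const_nhds
  refine le_of_tendsto ((M.continuous_hermQuad.tendsto _).comp
    (hzlim.mono_left (nhdsWithin_le_nhds (s := {0}ᶜ)))) ?_
  filter_upwards [self_mem_nhdsWithin, nhdsWithin_le_nhds hU] with ε h1 h2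
  have hε : (ε : ℂ) ≠ 0 := by simpa using h1
  set D := Complex.I • (1 : Matrix (Fin n) (Fin n) ℂ) - (ε : ℂ) • A.toComplex with hD
  have hDω : (Complex.I * ((ε⁻¹ : ℝ) : ℂ)) • (1 : Matrix (Fin n) (Fin n) ℂ) - A.toComplex =
      (ε : ℂ)⁻¹ • D := by
    rw [hD, smul_sub, smul_smul, smul_smul, inv_mul_cancel₀ hε, one_smul, Complex.ofReal_inv,
      mul_comm]
  have hunit : IsUnit ((Complex.I * ((ε⁻¹ : ℝ) : ℂ)) • (1 : Matrix (Fin n) (Fin n) ℂ) -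
      A.toComplex) := by
    rw [hDω, isUnit_iff_isUnit_det, det_smul]
    exact ((inv_ne_zero hε).isUnit.pow _).mul ((isUnit_iff_isUnit_det _).1 h2)
  have hsol : (Complex.I * ((ε⁻¹ : ℝ) : ℂ)) • x' ε =
      A.toComplex *ᵥ x' ε + B.toComplex *ᵥ u := by
    have e1 : D *ᵥ x' ε = (ε : ℂ) • (B.toComplex *ᵥ u) := by
      rw [hx', mulVec_mulVec, mul_nonsing_inv _ ((isUnit_iff_isUnit_det _).1 h2), one_mulVec]
    have e2 : ((Complex.I * ((ε⁻¹ : ℝ) : ℂ)) • (1 : Matrix (Fin n) (Fin n) ℂ) -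
        A.toComplex) *ᵥ x' ε = B.toComplex *ᵥ u := by
      rw [hDω, smul_mulVec, e1, smul_smul, inv_mul_cancel₀ hε, one_smul]
    rw [sub_mulVec, smul_mulVec, one_mulVec] at e2
    rw [← e2]
    abel
  rw [Function.comp_apply, ← frequencyMatrix_mulVec_eq hunit hsol]
  exact h _ hunit _

end Frequency

/-! ### Traces and generalised inverses. -/

namespace Matrix

lemma quad_transpose_mul_mul {ι κ : Type*} [Fintype ι] [Fintype κ] (N : Matrix ι ι ℝ)
    (Y : Matrix ι κ ℝ) (z : κ → ℝ) : (Yᵀ * N * Y).quad z = N.quad (Y *ᵥ z) := by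
  rw [quad, quad, ← mulVec_mulVec, ← mulVec_mulVec, dotProduct_mulVec, vecMul_transpose]

lemma hermQuad_transpose_mul_mul {ι κ : Type*} [Fintype ι] [Fintype κ] (N : Matrix ι ι ℝ)
    (Y : Matrix ι κ ℝ) (z : κ → ℂ) :
    (Yᵀ * N * Y).hermQuad z = N.hermQuad (Y.toComplex *ᵥ z) := by
  simp only [hermQuad, quad_transpose_mul_mul, toComplex_mulVec_re, toComplex_mulVec_im]

lemma hermQuad_ofReal {ι : Type*} [Fintype ι] (N : Matrix ι ι ℝ) (z : ι → ℝ) :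
    N.hermQuad (fun i => (z i : ℂ)) = N.quad z := by
  have : (fun _ : ι => (0 : ℝ)) = 0 := rfl
  simp [hermQuad, this, quad_zero]

lemma trace_eq_sum_quad {ι κ : Type*} [Fintype ι] [Fintype κ] (N : Matrix ι ι ℝ)
    (Y : Matrix ι κ ℝ) : (Yᵀ * N * Y).trace = ∑ k, N.quad (fun i => Y i k) := by
  refine Finset.sum_congr rfl fun k _ => ?_
  rw [diag_apply, Matrix.mul_assoc, mul_apply]
  rfl

/-- The trace of a symmetric matrix, computed in an orthonormal eigenbasis of another matrix. -/
lemma IsSymm.trace_eq_sum_hermQuad {κ : Type*} [Fintype κ] [DecidableEq κ] {N : Matrix κ κ ℝ}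
    (hN : N.IsSymm) {T : Matrix κ κ ℂ} (hT : T.IsHermitian) :
    N.trace = ∑ k, N.hermQuad (fun i => hT.eigenvectorBasis k i) := by
  set V : Matrix κ κ ℂ := (hT.eigenvectorUnitary : Matrix κ κ ℂ) with hV
  have hVV : V * Vᴴ = 1 := Unitary.coe_mul_star_self hT.eigenvectorUnitary
  have h1 : (N.trace : ℂ) = (Vᴴ * (N.toComplex * V)).trace := by
    rw [trace_mul_comm, Matrix.mul_assoc, hVV, Matrix.mul_one]
    simp [trace, toComplex]
  have h2 : (N.trace : ℂ) = ((∑ k, N.hermQuad (fun i => hT.eigenvectorBasis k i) : ℝ) : ℂ) := by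
    rw [h1, Complex.ofReal_sum]
    refine Finset.sum_congr rfl fun k _ => ?_
    rw [← hN.star_dotProduct_toComplex_mulVec]
    rfl
  exact_mod_cast h2

/-- A symmetric generalised inverse of a Gram matrix. -/
lemma exists_isSymm_gram_inverse {ι κ : Type*} [Fintype ι] [DecidableEq ι] [Fintype κ]
    (X : Matrix ι κ ℝ) : ∃ Q : Matrix ι ι ℝ, Q.IsSymm ∧ X * Xᵀ * Q * X = X := by
  have hG : (X * Xᵀ).IsHermitian := by
    simpa using isHermitian_mul_conjTranspose_self X
  set φ := Unitary.conjStarAlgAut ℝ (Matrix ι ι ℝ) hG.eigenvectorUnitary with hφ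
  set d : ι → ℝ := hG.eigenvalues with hd
  have hGd : X * Xᵀ = φ (diagonal d) := by
    simpa [hφ, hd, Function.comp_def] using hG.spectral_theorem
  -- By the convention `0⁻¹ = 0`, inverting the eigenvalues one by one gives the Moore–Penrose
  -- inverse of `X Xᵀ`.
  have hQ : (φ (diagonal fun i => (d i)⁻¹)).IsSymm := by
    have : star (φ (diagonal fun i => (d i)⁻¹)) = φ (diagonal fun i => (d i)⁻¹) := by
      rw [← map_star, star_eq_conjTranspose, diagonal_conjTranspose]
      simp
    rw [star_eq_conjTranspose, conjTranspose_eq_transpose_of_trivial] at this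
    exact this
  refine ⟨φ (diagonal fun i => (d i)⁻¹), hQ, ?_⟩
  set Q := φ (diagonal fun i => (d i)⁻¹) with hQdef
  have hGQG : X * Xᵀ * Q * (X * Xᵀ) = X * Xᵀ := by
    rw [hGd, hQdef, ← map_mul, ← map_mul, diagonal_mul_diagonal, diagonal_mul_diagonal]
    congr 2
    ext i
    by_cases h : d i = 0 <;> simp [h]
  have h0 : (X * Xᵀ * Q - 1) * (X * Xᴴ) = 0 := by
    rw [conjTranspose_eq_transpose_of_trivial, sub_mul, hGQG, one_mul, sub_self]
  rw [mul_self_mul_conjTranspose_eq_zero, Matrix.sub_mul, Matrix.one_mul, sub_eq_zero] at h0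
  exact h0

end Matrix

/-! ### Functionals that annihilate the blocks. -/

section Algebra

variable {n m : ℕ} {A : Matrix (Fin n) (Fin n) ℝ} {B : Matrix (Fin n) (Fin m) ℝ}
  {M : Matrix (Fin n ⊕ Fin m) (Fin n ⊕ Fin m) ℝ}

/-- If `W Xᵀ` is skew-symmetric for `W = A X + B U`, then the columns of `[X; U]` can be traded,
by a unitary change of basis, for vectors with `x = 0` or `i ω x = A x + B u`. -/
lemma trace_nonpos_of_skew {r : ℕ} (hM : M.IsSymm)
    (hC : ∀ (x : Fin n → ℂ) (u : Fin m → ℂ),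
      (x = 0 ∨ ∃ ω : ℝ, (Complex.I * (ω : ℂ)) • x = A.toComplex *ᵥ x + B.toComplex *ᵥ u) →
        M.hermQuad (Sum.elim x u) ≤ 0)
    (X : Matrix (Fin n) (Fin r) ℝ) (U : Matrix (Fin m) (Fin r) ℝ)
    (hskew : ((A * X + B * U) * Xᵀ)ᵀ = -((A * X + B * U) * Xᵀ)) :
    ((fromRows X U)ᵀ * M * fromRows X U).trace ≤ 0 := by
  obtain ⟨Q, hQ, hXQ⟩ := exists_isSymm_gram_inverse X
  set W := A * X + B * U with hW
  set K := W * Xᵀ with hK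
  -- `p` is the orthogonal projection onto the row space of `X`. The skew matrix `S` represents `W`
  -- there, in the sense that `X S = W p`.
  set p : Matrix (Fin r) (Fin r) ℝ := Xᵀ * Q * X with hp
  set S : Matrix (Fin r) (Fin r) ℝ := Xᵀ * (Q * K * Q) * X with hS
  have hXp : X * p = X := by
    rw [hp, ← Matrix.mul_assoc, ← Matrix.mul_assoc, hXQ]
  have hpT : pᵀ = p := by
    rw [hp]; simp only [transpose_mul, transpose_transpose, hQ.eq, Matrix.mul_assoc]
  have hpp : p * p = p := by
    nth_rw 1 [hp]
    rw [Matrix.mul_assoc, hXp]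
  have hST : Sᵀ = -S := by
    rw [hS]
    simp only [transpose_mul, transpose_transpose, hQ.eq, hskew, Matrix.mul_assoc,
      Matrix.mul_neg, Matrix.neg_mul]
  have hXS : X * S = W * p := by
    -- Skewness gives `K = -X Wᵀ`, so the columns of `K` lie in the range of `X`, where `X Xᵀ Q` is
    -- the identity.
    have hKX : X * Xᵀ * Q * K = K := by
      have : K = -(X * Wᵀ) := by
        rw [← neg_eq_iff_eq_neg, ← hskew, hK, transpose_mul, transpose_transpose]
      rw [this, Matrix.mul_neg, ← Matrix.mul_assoc, hXQ]
    calc X * S = X * Xᵀ * Q * K * (Q * X) := by rw [hS]; simp only [Matrix.mul_assoc]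
      _ = W * p := by rw [hKX, hK, hp]; simp only [Matrix.mul_assoc]
  set Z := fromRows X U with hZ
  set N := Zᵀ * M * Z with hN
  have hNs : ∀ Y : Matrix (Fin r) (Fin r) ℝ, (Yᵀ * N * Y).IsSymm := fun Y => by
    rw [IsSymm, hN]
    simp only [transpose_mul, transpose_transpose, hM.eq, Matrix.mul_assoc]
  have hNY : ∀ Y : Matrix (Fin r) (Fin r) ℝ, Yᵀ * N * Y = (Z * Y)ᵀ * M * (Z * Y) := fun Y => by
    rw [hN]
    simp only [transpose_mul, Matrix.mul_assoc]
  have hqT : (1 - p)ᵀ = 1 - p := by rw [transpose_sub, transpose_one, hpT]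
  have hsplit : N.trace = (pᵀ * N * p).trace + ((1 - p)ᵀ * N * (1 - p)).trace := by
    have hq : (1 - p) * (1 - p) = 1 - p := by
      simp [mul_sub, sub_mul, hpp]
    rw [trace_mul_cycle pᵀ, trace_mul_cycle (1 - p)ᵀ, hpT, hqT, hpp, hq, ← trace_add, ← add_mul,
      add_sub_cancel, one_mul]
  -- An eigenvector `v` of the Hermitian matrix `i S` gives `x = X v` and `u = U p v` with `A x + B
  -- u = W p v = X S v = iω x`. From `i S v = ev v` the frequency is `ω = -ev`.
  have hfirst : (pᵀ * N * p).trace ≤ 0 := by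
    have hT : (Complex.I • S.toComplex).IsHermitian := by
      rw [IsHermitian, conjTranspose_smul, toComplex_conjTranspose, hST]
      ext i j
      simp [toComplex]
    rw [(hNs p).trace_eq_sum_hermQuad hT]
    refine Finset.sum_nonpos fun k _ => ?_
    set v : Fin r → ℂ := fun i => hT.eigenvectorBasis k i
    set ev : ℝ := hT.eigenvalues k with hev
    rw [hNY, hermQuad_transpose_mul_mul, hZ, fromRows_mul]
    have hfr : (fromRows (X * p) (U * p)).toComplex *ᵥ v =
        Sum.elim ((X * p).toComplex *ᵥ v) ((U * p).toComplex *ᵥ v) := by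
      ext (i | i) <;> rfl
    rw [hfr]
    refine hC _ _ (Or.inr ⟨-ev, ?_⟩)
    have hSv : S.toComplex *ᵥ v = (Complex.I * ((-ev : ℝ) : ℂ)) • v := by
      have h1 : (Complex.I • S.toComplex) *ᵥ v = (ev : ℂ) • v := by
        have := hT.mulVec_eigenvectorBasis k
        rw [RCLike.real_smul_eq_coe_smul (K := ℂ)] at this
        exact this
      have h2 : S.toComplex *ᵥ v = (-Complex.I) • ((Complex.I • S.toComplex) *ᵥ v) := by
        rw [smul_mulVec, smul_smul]; simp
      rw [h2, h1, smul_smul]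
      push_cast
      ring_nf
    rw [mulVec_mulVec, mulVec_mulVec, ← add_mulVec, ← toComplex_mul, ← toComplex_mul]
    have hadd : (A * (X * p)).toComplex + (B * (U * p)).toComplex = (X * S).toComplex := by
      rw [hXS, hW, Matrix.add_mul, Matrix.mul_assoc, Matrix.mul_assoc]
      ext i j
      simp [toComplex]
    rw [hadd, hXp, toComplex_mul, ← mulVec_mulVec, hSv, mulVec_smul]
  -- On the complement `X (1 - p) = 0`, so the columns have `x = 0`.
  have hsecond : ((1 - p)ᵀ * N * (1 - p)).trace ≤ 0 := by
    rw [hNY, trace_eq_sum_quad]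
    refine Finset.sum_nonpos fun k _ => ?_
    have hX0 : X * (1 - p) = 0 := by rw [Matrix.mul_sub, hXp, Matrix.mul_one, sub_self]
    rw [hZ, fromRows_mul, hX0, ← hermQuad_ofReal]
    have := hC 0 (fun i => (((U * (1 - p) : Matrix (Fin m) (Fin r) ℝ) i k : ℝ) : ℂ)) (Or.inl rfl)
    refine le_of_eq_of_le (congrArg _ ?_) this
    ext (i | i) <;> simp
  rw [hsplit]
  exact add_nonpos hfirst hsecond

/-- A positive semidefinite functional that annihilates all `lmiBlock A B P` is nonpositive
at `M`. -/
lemma sum_quad_nonpos {r : ℕ} (hM : M.IsSymm)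
    (hC : ∀ (x : Fin n → ℂ) (u : Fin m → ℂ),
      (x = 0 ∨ ∃ ω : ℝ, (Complex.I * (ω : ℂ)) • x = A.toComplex *ᵥ x + B.toComplex *ᵥ u) →
        M.hermQuad (Sum.elim x u) ≤ 0)
    (z : Fin r → Fin n ⊕ Fin m → ℝ)
    (hL : ∀ P : Matrix (Fin n) (Fin n) ℝ, P.IsSymm → ∑ k, (lmiBlock A B P).quad (z k) = 0) :
    ∑ k, M.quad (z k) ≤ 0 := by
  set X : Matrix (Fin n) (Fin r) ℝ := of fun i k => z k (Sum.inl i) with hX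
  set U : Matrix (Fin m) (Fin r) ℝ := of fun i k => z k (Sum.inr i) with hU
  have hz : ∀ k, (fun i => fromRows X U i k) = z k := fun k => by
    ext (i | i) <;> simp [hX, hU]
  have hz' : ∀ k, z k = Sum.elim (fun i => X i k) (fun i => U i k) := fun k => by
    ext (i | i) <;> simp [hX, hU]
  set W := A * X + B * U with hW
  have hPW : ∀ P : Matrix (Fin n) (Fin n) ℝ, P.IsSymm → (P * (W * Xᵀ)).trace = 0 := by
    intro P hP
    have h1 := hL P hP
    simp only [hz', lmiBlock_quad A B hP] at h1
    rw [← Finset.mul_sum] at h1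
    have h2 : (P * (W * Xᵀ)).trace = (Xᵀ * (P * W)).trace := by
      rw [← Matrix.mul_assoc, trace_mul_comm]
    rw [h2]
    refine Eq.trans (Finset.sum_congr rfl fun k _ => ?_)
      ((mul_eq_zero.1 h1).resolve_left two_ne_zero)
    rw [diag_apply, mul_apply]
    rfl
  have hskew : (W * Xᵀ)ᵀ = -(W * Xᵀ) := by
    set K := W * Xᵀ with hK
    -- Testing against `P = Kᵀ + K` itself makes the Frobenius norm of the symmetric part of `K`
    -- vanish.
    have hs : (Kᵀ + K).IsSymm := by rw [IsSymm, transpose_add, transpose_transpose, add_comm]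
    have h1 := hPW _ hs
    have h2 : ((Kᵀ + K) * Kᵀ).trace = 0 := by
      rw [← trace_transpose, transpose_mul, transpose_transpose, hs.eq, trace_mul_comm, h1]
    have h3 : ((Kᵀ + K)ᴴ * (Kᵀ + K)).trace = 0 := by
      rw [conjTranspose_eq_transpose_of_trivial, hs.eq]
      nth_rw 2 [add_comm]
      rw [mul_add, trace_add, h1, h2, add_zero]
    exact eq_neg_of_add_eq_zero_left (trace_conjTranspose_mul_self_eq_zero_iff.1 h3)
  have := trace_nonpos_of_skew hM hC X U hskew
  rw [trace_eq_sum_quad] at this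
  simpa only [hz] using this

end Algebra

/-! ### Separation from the cone of solvable inequalities, and its closedness. -/

section Separation

variable {n m : ℕ} (A : Matrix (Fin n) (Fin n) ℝ) (B : Matrix (Fin n) (Fin m) ℝ)

lemma lmiBlock_add (P P' : Matrix (Fin n) (Fin n) ℝ) :
    lmiBlock A B (P + P') = lmiBlock A B P + lmiBlock A B P' := by
  simp only [lmiBlock, fromBlocks_add, Matrix.mul_add, Matrix.add_mul, add_zero]
  congr 1
  abel

lemma lmiBlock_smul (c : ℝ) (P : Matrix (Fin n) (Fin n) ℝ) :
    lmiBlock A B (c • P) = c • lmiBlock A B P := by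
  simp [lmiBlock, fromBlocks_smul]

lemma continuous_lmiBlock : Continuous (lmiBlock A B) := by
  unfold lmiBlock
  fun_prop

/-- The matrices that dominate some `lmiBlock A B P`. -/
def lmiCone : Set (Matrix (Fin n ⊕ Fin m) (Fin n ⊕ Fin m) ℝ) :=
  {N | ∃ P : Matrix (Fin n) (Fin n) ℝ, P.IsSymm ∧ (N - lmiBlock A B P).PosSemidef}

lemma smul_mem_lmiCone {N : Matrix (Fin n ⊕ Fin m) (Fin n ⊕ Fin m) ℝ} (hN : N ∈ lmiCone A B)
    {c : ℝ} (hc : 0 ≤ c) : c • N ∈ lmiCone A B := by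
  obtain ⟨P, hP, h⟩ := hN
  refine ⟨c • P, hP.smul c, ?_⟩
  rw [lmiBlock_smul, ← smul_sub]
  exact h.smul hc

lemma convex_lmiCone : Convex ℝ (lmiCone A B) := by
  intro N hN N' hN' a b ha hb _
  obtain ⟨P, hP, h⟩ := smul_mem_lmiCone A B hN ha
  obtain ⟨P', hP', h'⟩ := smul_mem_lmiCone A B hN' hb
  refine ⟨P + P', hP.add hP', ?_⟩
  rw [lmiBlock_add, add_sub_add_comm]
  exact h.add h'

lemma lmiBlock_mem_lmiCone {P : Matrix (Fin n) (Fin n) ℝ} (hP : P.IsSymm) :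
    lmiBlock A B P ∈ lmiCone A B :=
  ⟨P, hP, by rw [sub_self]; exact PosSemidef.zero⟩

lemma mem_lmiCone_of_posSemidef {N : Matrix (Fin n ⊕ Fin m) (Fin n ⊕ Fin m) ℝ}
    (hN : N.PosSemidef) : N ∈ lmiCone A B :=
  ⟨0, isSymm_zero, by simpa [lmiBlock] using hN⟩

variable {A B}

/-- A linear functional on matrices that is nonnegative on positive semidefinite matrices is, on
symmetric matrices, a sum of values of the quadratic form. -/
lemma Matrix.exists_sum_quad_of_nonneg {ι : Type*} [Fintype ι] [DecidableEq ι]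
    (f : Matrix ι ι ℝ →ₗ[ℝ] ℝ) (hf : ∀ N : Matrix ι ι ℝ, N.PosSemidef → 0 ≤ f N) :
    ∃ (r : ℕ) (z : Fin r → ι → ℝ), ∀ N : Matrix ι ι ℝ, N.IsSymm → f N = ∑ k, N.quad (z k) := by
  -- `H` represents `f` on symmetric matrices. Testing `f` on `x xᵀ` shows it positive semidefinite,
  -- and a decomposition of `H` into rank-one terms supplies the vectors `z`.
  set H : Matrix ι ι ℝ := of fun i j => (f (single i j 1) + f (single j i 1)) / 2 with hH
  have hsum : ∀ N : Matrix ι ι ℝ, f N = ∑ i, ∑ j, N i j * f (single i j 1) := fun N => by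
    conv_lhs => rw [matrix_eq_sum_single N]
    simp only [map_sum]
    refine Finset.sum_congr rfl fun i _ => Finset.sum_congr rfl fun j _ => ?_
    rw [← smul_eq_mul, ← map_smul, smul_single, smul_eq_mul, mul_one]
  have hsymm : ∀ N : Matrix ι ι ℝ, N.IsSymm → f N = ∑ i, ∑ j, N i j * H i j := fun N hN => by
    have h1 : f N = ∑ i, ∑ j, N i j * f (single j i 1) := by
      rw [hsum, Finset.sum_comm]
      exact Finset.sum_congr rfl fun i _ => Finset.sum_congr rfl fun j _ => by
        rw [hN.apply i j]
    have h2 : f N = (f N + f N) / 2 := by ring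
    rw [h2]
    nth_rw 1 [hsum]
    rw [h1, ← Finset.sum_add_distrib, Finset.sum_div]
    refine Finset.sum_congr rfl fun i _ => ?_
    rw [← Finset.sum_add_distrib, Finset.sum_div]
    refine Finset.sum_congr rfl fun j _ => ?_
    simp only [hH, of_apply]
    ring
  have hHpsd : H.PosSemidef := by
    refine PosSemidef.of_dotProduct_mulVec_nonneg ?_ fun x => ?_
    · ext i j
      simp [hH, add_comm]
    · have h1 : (vecMulVec x (star x)).PosSemidef := posSemidef_vecMulVec_self_star x
      have h2 := hf _ h1
      rw [hsymm _ (by simp [IsSymm])] at h2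
      have h3 : star x ⬝ᵥ (H *ᵥ x) = H.quad x := by simp [quad]
      rw [h3, quad_eq_sum]
      simpa [vecMulVec_apply, mul_comm] using h2
  obtain ⟨r, z, hz⟩ := posSemidef_iff_eq_sum_vecMulVec.1 hHpsd
  refine ⟨r, z, fun N hN => ?_⟩
  rw [hsymm N hN]
  simp only [quad_eq_sum]
  rw [Finset.sum_comm]
  simp only [Finset.sum_comm (s := (Finset.univ : Finset (Fin r)))]
  rw [Finset.sum_comm]
  refine Finset.sum_congr rfl fun i _ => Finset.sum_congr rfl fun j _ => ?_
  rw [hz, sum_apply, Finset.mul_sum]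
  simp [vecMulVec_apply]

variable {M : Matrix (Fin n ⊕ Fin m) (Fin n ⊕ Fin m) ℝ}

/-- A functional separating `-M` from the closed cone is nonnegative on the cone and vanishes on the
blocks, since the cone contains them with both signs. `sum_quad_nonpos` then contradicts `f M > 0`.
-/
lemma neg_mem_closure_lmiCone (hM : M.IsSymm)
    (hC : ∀ (x : Fin n → ℂ) (u : Fin m → ℂ),
      (x = 0 ∨ ∃ ω : ℝ, (Complex.I * (ω : ℂ)) • x = A.toComplex *ᵥ x + B.toComplex *ᵥ u) →
        M.hermQuad (Sum.elim x u) ≤ 0) : -M ∈ closure (lmiCone A B) := by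
  by_contra hmem
  have : LocallyConvexSpace ℝ (Matrix (Fin n ⊕ Fin m) (Fin n ⊕ Fin m) ℝ) :=
    inferInstanceAs (LocallyConvexSpace ℝ (Fin n ⊕ Fin m → Fin n ⊕ Fin m → ℝ))
  obtain ⟨f, c, hfM, hfK⟩ := geometric_hahn_banach_point_closed
    (convex_lmiCone A B).closure isClosed_closure hmem
  have hc0 : c < 0 := by
    have := hfK 0 (subset_closure (mem_lmiCone_of_posSemidef A B PosSemidef.zero))
    simpa using this
  -- Were `f N` negative, the nonnegative multiple `c / f N` of `N` would stay in the cone and take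
  -- the value `c`, which is excluded.
  have hK : ∀ N ∈ lmiCone A B, 0 ≤ f N := by
    intro N hN
    by_contra! hneg
    have := hfK _ (subset_closure (smul_mem_lmiCone A B hN
      (div_nonneg_of_nonpos hc0.le hneg.le : 0 ≤ c / f N)))
    rw [map_smul, smul_eq_mul, div_mul_cancel₀ _ hneg.ne] at this
    exact lt_irrefl _ this
  obtain ⟨r, z, hz⟩ := exists_sum_quad_of_nonneg f.toLinearMap
    fun N hN => hK N (mem_lmiCone_of_posSemidef A B hN)
  have hL : ∀ P : Matrix (Fin n) (Fin n) ℝ, P.IsSymm → ∑ k, (lmiBlock A B P).quad (z k) = 0 := by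
    intro P hP
    rw [← hz _ (lmiBlock_isSymm A B hP)]
    have h1 := hK _ (lmiBlock_mem_lmiCone A B hP)
    have h2 := hK _ (lmiBlock_mem_lmiCone A B (hP.smul (-1 : ℝ)))
    rw [lmiBlock_smul, map_smul, smul_eq_mul] at h2
    exact le_antisymm (by simpa using h2) h1
  have h1 := sum_quad_nonpos hM hC z hL
  rw [← hz M hM] at h1
  have h2 : f (-M) = -f M := map_neg f M
  have h3 : f M ≤ 0 := h1
  linarith

/-- By polarisation, pointwise bounds on a quadratic form bound its entries. -/
lemma Matrix.IsSymm.abs_apply_le_of_quad {ι : Type*} [Fintype ι] [DecidableEq ι] {P : Matrix ι ι ℝ}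
    (hP : P.IsSymm) (i j : ι) :
    |P i j| ≤ |P.quad (Pi.single i 1 + Pi.single j 1)| + |P.quad (Pi.single i 1)| +
      |P.quad (Pi.single j 1)| := by
  have h1 : ∀ k l, Pi.single k 1 ⬝ᵥ (P *ᵥ Pi.single l 1) = P k l := fun k l => by
    simp
  have h2 : P.quad (Pi.single i 1 + Pi.single j 1) = P i i + P j j + 2 * P i j := by
    rw [quad, mulVec_add, add_dotProduct, dotProduct_add, dotProduct_add, h1, h1, h1, h1,
      hP.apply i j]
    ring
  have h3 : ∀ k, P.quad (Pi.single k 1) = P k k := fun k => h1 k k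
  rw [h2, h3, h3]
  have h4 : P i j = ((P i i + P j j + 2 * P i j) - P i i - P j j) / 2 := by ring
  rcases abs_cases (P i i + P j j + 2 * P i j) with h | h <;>
  rcases abs_cases (P i i) with h' | h' <;> rcases abs_cases (P j j) with h'' | h'' <;>
  rcases abs_cases (P i j) with h''' | h''' <;> linarith

/-- The set of solvable linear matrix inequalities is closed for a controllable pair. -/
lemma Controllable.isClosed_lmiCone (hAB : Controllable A B) : IsClosed (lmiCone A B) := by
  have : SequentialSpace (Matrix (Fin n ⊕ Fin m) (Fin n ⊕ Fin m) ℝ) :=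
    inferInstanceAs (SequentialSpace (Fin n ⊕ Fin m → Fin n ⊕ Fin m → ℝ))
  refine isSeqClosed_iff_isClosed.1 fun N N₀ hN hlim => ?_
  choose P hP hPN using hN
  have hS : Filter.Tendsto (fun k => ∑ i, ∑ j, |(-N k) i j|) Filter.atTop
      (nhds (∑ i, ∑ j, |(-N₀) i j|)) := by
    have : Continuous fun N : Matrix (Fin n ⊕ Fin m) (Fin n ⊕ Fin m) ℝ =>
        ∑ i, ∑ j, |(-N) i j| := by fun_prop
    exact (this.tendsto N₀).comp hlim
  obtain ⟨D, hD⟩ := hS.bddAbove_range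
  -- Each `P k` is a storage function for `-N k`, and these matrices are bounded because they
  -- converge. The `P k` therefore stay in a compact box, and a subsequence converges.
  have hbound : ∀ v, ∃ E : ℝ, ∀ k, |(P k).quad v| ≤ E := fun v => by
    obtain ⟨C, hC, h⟩ := hAB.exists_quad_bound v
    refine ⟨C * D, fun k => (h (-N k) (P k) (hP k) ?_).trans
      (mul_le_mul_of_nonneg_left (hD ⟨k, rfl⟩) hC)⟩
    rw [neg_add, neg_neg, ← sub_eq_add_neg]
    exact hPN k
  choose E hE using hbound
  set b : Fin n → Fin n → ℝ := fun i j =>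
    E (Pi.single i 1 + Pi.single j 1) + E (Pi.single i 1) + E (Pi.single j 1) with hb
  have hcompact : IsCompact (Set.univ.pi fun i => Set.univ.pi fun j => Set.Icc (-b i j) (b i j)) :=
    isCompact_univ_pi fun i => isCompact_univ_pi fun j => isCompact_Icc
  obtain ⟨P₀, -, φ, hφ, hPlim⟩ := hcompact.tendsto_subseq (x := fun k i j => P k i j)
    fun k i _ j _ => abs_le.1 ((IsSymm.abs_apply_le_of_quad (hP k) i j).trans
      (add_le_add (add_le_add (hE _ k) (hE _ k)) (hE _ k)))
  have hPlim' : Filter.Tendsto (fun k => P (φ k)) Filter.atTop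
      (nhds (of P₀ : Matrix (Fin n) (Fin n) ℝ)) := hPlim
  have hP₀ : (of P₀ : Matrix (Fin n) (Fin n) ℝ).IsSymm := by
    refine tendsto_nhds_unique ((Continuous.matrix_transpose continuous_id).tendsto _ |>.comp
      hPlim') ?_
    simpa [Function.comp_def, (hP _).eq] using hPlim'
  refine ⟨of P₀, hP₀, ?_⟩
  have hlimD : Filter.Tendsto (fun k => N (φ k) - lmiBlock A B (P (φ k))) Filter.atTop
      (nhds (N₀ - lmiBlock A B (of P₀))) :=
    (hlim.comp hφ.tendsto_atTop).sub (((continuous_lmiBlock A B).tendsto _).comp hPlim')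
  refine PosSemidef.of_dotProduct_mulVec_nonneg ?_ fun x => ?_
  · refine tendsto_nhds_unique ((Continuous.matrix_conjTranspose continuous_id).tendsto _ |>.comp
      hlimD) ?_
    simpa only [Function.comp_def, id, (hPN _).isHermitian.eq] using hlimD
  · have hc : Continuous fun N : Matrix (Fin n ⊕ Fin m) (Fin n ⊕ Fin m) ℝ =>
        star x ⬝ᵥ (N *ᵥ x) := by fun_prop
    exact ge_of_tendsto' ((hc.tendsto _).comp hlimD) fun k =>
      (hPN (φ k)).dotProduct_mulVec_nonneg x

/-- The frequency-domain inequality implies the linear matrix inequality. -/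
lemma exists_lmi_of_hermQuad (hM : M.IsSymm) (hAB : Controllable A B)
    (hC : ∀ (x : Fin n → ℂ) (u : Fin m → ℂ),
      (x = 0 ∨ ∃ ω : ℝ, (Complex.I * (ω : ℂ)) • x = A.toComplex *ᵥ x + B.toComplex *ᵥ u) →
        M.hermQuad (Sum.elim x u) ≤ 0) :
    ∃ P : Matrix (Fin n) (Fin n) ℝ, P.IsSymm ∧ (-(M + lmiBlock A B P)).PosSemidef := by
  obtain ⟨P, hP, h⟩ := hAB.isClosed_lmiCone.closure_subset (neg_mem_closure_lmiCone hM hC)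
  exact ⟨P, hP, by rwa [neg_add, ← sub_eq_add_neg]⟩

end Separation

/-! ### Cutting and gluing trajectories. -/

section Window

variable {E : Type*} [NormedAddCommGroup E] {g : ℝ → E} {a b : ℝ}

lemma ContinuousOn.memLp_indicator_Ico (hg : ContinuousOn g (Set.Icc a b)) (p : ENNReal) :
    MemLp ((Set.Ico a b).indicator g) p volume := by
  rw [memLp_indicator_iff_restrict measurableSet_Ico]
  obtain ⟨C, hC⟩ := isCompact_Icc.exists_bound_of_continuousOn hg
  refine MemLp.of_bound ((hg.mono Set.Ico_subset_Icc_self).aestronglyMeasurable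
    measurableSet_Ico) C ?_
  filter_upwards [ae_restrict_mem measurableSet_Ico] with t ht
  exact hC t (Set.Ico_subset_Icc_self ht)

lemma ContinuousOn.ae_continuousAt_indicator_Ico (hg : ContinuousOn g (Set.Icc a b)) :
    ∀ᵐ t, ContinuousAt ((Set.Ico a b).indicator g) t := by
  have ha : ∀ᵐ t : ℝ, t ≠ a := by simp [ae_iff, measure_singleton]
  have hb : ∀ᵐ t : ℝ, t ≠ b := by simp [ae_iff, measure_singleton]
  filter_upwards [ha, hb] with t hta htb
  by_cases h : t ∈ Set.Ioo a b
  · refine (hg.continuousAt (Icc_mem_nhds h.1 h.2)).congr ?_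
    filter_upwards [Ioo_mem_nhds h.1 h.2] with s hs
    rw [Set.indicator_of_mem (Set.Ioo_subset_Ico_self hs)]
  · have : t ∈ (Set.Icc a b)ᶜ := fun h' =>
      h ⟨lt_of_le_of_ne h'.1 hta.symm, lt_of_le_of_ne h'.2 htb⟩
    refine (continuousAt_const (y := (0 : E))).congr ?_
    filter_upwards [isClosed_Icc.isOpen_compl.mem_nhds this] with s hs
    rw [Set.indicator_of_notMem fun h' => hs (Set.Ico_subset_Icc_self h')]

lemma ContinuousOn.integral_indicator_Ico [NormedSpace ℝ E] (hab : a ≤ b)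
    (hg : ContinuousOn g (Set.Icc a b)) :
    Integrable ((Set.Ico a b).indicator g) ∧
      ∫ t, (Set.Ico a b).indicator g t = ∫ t in a..b, g t := by
  refine ⟨memLp_one_iff_integrable.1 (hg.memLp_indicator_Ico 1), ?_⟩
  rw [integral_indicator measurableSet_Ico, integral_Ico_eq_integral_Ioc,
    intervalIntegral.integral_of_le hab]

end Window

namespace SatisfiesLTI

variable {n m : ℕ} {A : Matrix (Fin n) (Fin n) ℝ} {B : Matrix (Fin n) (Fin m) ℝ}
  {x : ℝ → Fin n → ℝ} {u : ℝ → Fin m → ℝ} {J K : Set ℝ}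

lemma union (hJ : SatisfiesLTI A B J x u) (hK : SatisfiesLTI A B K x u) {c : ℝ} (hcJ : c ∈ J)
    (hcK : c ∈ K) : SatisfiesLTI A B (J ∪ K) x u := by
  have hc : ∀ s ∈ J ∪ K, IntervalIntegrable (fun τ => A *ᵥ x τ + B *ᵥ u τ) volume s c ∧
      x c - x s = ∫ τ in s..c, (A *ᵥ x τ + B *ᵥ u τ) := by
    rintro s (hs | hs)
    · exact hJ s hs c hcJ
    · exact hK s hs c hcK
  intro s hs t ht
  obtain ⟨hs1, hs2⟩ := hc s hs
  obtain ⟨ht1, ht2⟩ := hc t ht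
  refine ⟨hs1.trans ht1.symm, ?_⟩
  rw [← intervalIntegral.integral_add_adjacent_intervals hs1 ht1.symm,
    intervalIntegral.integral_symm t c, ← hs2, ← ht2]
  abel

/-- The state is evaluated at the endpoints, so it must agree everywhere on `J`; the input occurs
only under the integral, so agreement almost everywhere suffices. This tolerates jumps of the input
at the joints of glued trajectories. -/
lemma congr (h : SatisfiesLTI A B J x u) (hJ : J.OrdConnected) {x' : ℝ → Fin n → ℝ}
    {u' : ℝ → Fin m → ℝ} (hx : ∀ t ∈ J, x' t = x t) (hu : ∀ᵐ t, t ∈ J → u' t = u t) :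
    SatisfiesLTI A B J x' u' := by
  intro s hs t ht
  obtain ⟨h1, h2⟩ := h s hs t ht
  have hae : ∀ᵐ τ, τ ∈ Set.uIoc s t →
      A *ᵥ x τ + B *ᵥ u τ = A *ᵥ x' τ + B *ᵥ u' τ := by
    filter_upwards [hu] with τ hτ hτm
    have hτJ : τ ∈ J := hJ.uIcc_subset hs ht (Set.uIoc_subset_uIcc hτm)
    rw [hx τ hτJ, hτ hτJ]
  refine ⟨h1.congr_ae ((ae_restrict_iff' measurableSet_uIoc).2 hae), ?_⟩
  rw [hx s hs, hx t ht, h2, intervalIntegral.integral_congr_ae hae]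

lemma zero : SatisfiesLTI A B J 0 0 := by
  intro s _ t _
  simp

lemma comp_sub (h : SatisfiesLTI A B J x u) (c : ℝ) :
    SatisfiesLTI A B ((fun t => t - c) ⁻¹' J) (fun t => x (t - c)) (fun t => u (t - c)) := by
  intro s hs t ht
  obtain ⟨h1, h2⟩ := h _ hs _ ht
  refine ⟨by simpa using h1.comp_sub_right c, ?_⟩
  rw [h2, intervalIntegral.integral_comp_sub_right (fun τ => A *ᵥ x τ + B *ᵥ u τ)]

end SatisfiesLTI

/-! ### Long sinusoidal loops through the origin. -/

section Loop

variable {n m : ℕ} {A : Matrix (Fin n) (Fin n) ℝ} {B : Matrix (Fin n) (Fin m) ℝ}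
  {M : Matrix (Fin n ⊕ Fin m) (Fin n ⊕ Fin m) ℝ}

lemma ContinuousOn.quad_sumElim {x : ℝ → Fin n → ℝ} {u : ℝ → Fin m → ℝ} {s : Set ℝ}
    (hx : ContinuousOn x s) (hu : ContinuousOn u s) :
    ContinuousOn (fun t => M.quad (Sum.elim (x t) (u t))) s := by
  refine M.continuous_quad.comp_continuousOn (continuousOn_pi.2 ?_)
  rintro (i | i)
  · exact (continuous_apply i).comp_continuousOn hx
  · exact (continuous_apply i).comp_continuousOn hu

/-- Under the integral quadratic constraint, three trajectories that join up to a loop through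
the origin have nonpositive total cost. -/
lemma loop_integral_nonpos
    (h : ∀ (x : ℝ → Fin n → ℝ) (u : ℝ → Fin m → ℝ),
      (∀ᵐ t, ContinuousAt x t) → (∀ᵐ t, ContinuousAt u t) →
      MemLp x 2 volume → MemLp u 2 volume → (x = 0 ∨ SatisfiesLTI A B Set.univ x u) →
        ∫ t, M.quad (Sum.elim (x t) (u t)) ≤ 0)
    {a b c d : ℝ} (hab : a ≤ b) (hbc : b ≤ c) (hcd : c ≤ d)
    {x₁ x₂ x₃ : ℝ → Fin n → ℝ} {u₁ u₂ u₃ : ℝ → Fin m → ℝ}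
    (hx₁ : ContinuousOn x₁ (Set.Icc a b)) (hu₁ : ContinuousOn u₁ (Set.Icc a b))
    (hx₂ : ContinuousOn x₂ (Set.Icc b c)) (hu₂ : ContinuousOn u₂ (Set.Icc b c))
    (hx₃ : ContinuousOn x₃ (Set.Icc c d)) (hu₃ : ContinuousOn u₃ (Set.Icc c d))
    (h₁ : SatisfiesLTI A B (Set.Icc a b) x₁ u₁) (h₂ : SatisfiesLTI A B (Set.Icc b c) x₂ u₂)
    (h₃ : SatisfiesLTI A B (Set.Icc c d) x₃ u₃)
    (ha : x₁ a = 0) (hb : x₁ b = x₂ b) (hc : x₂ c = x₃ c) (hd : x₃ d = 0) :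
    (∫ t in a..b, M.quad (Sum.elim (x₁ t) (u₁ t))) +
      (∫ t in b..c, M.quad (Sum.elim (x₂ t) (u₂ t))) +
      (∫ t in c..d, M.quad (Sum.elim (x₃ t) (u₃ t))) ≤ 0 := by
  -- Half-open windows are disjoint, so every time belongs to at most one piece; at a joint the
  -- later piece decides.
  set x : ℝ → Fin n → ℝ := fun t => (Set.Ico a b).indicator x₁ t +
    (Set.Ico b c).indicator x₂ t + (Set.Ico c d).indicator x₃ t with hx
  set u : ℝ → Fin m → ℝ := fun t => (Set.Ico a b).indicator u₁ t +
    (Set.Ico b c).indicator u₂ t + (Set.Ico c d).indicator u₃ t with hu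
  have hne : ∀ e : ℝ, ∀ᵐ t : ℝ, t ≠ e := fun e => by simp [ae_iff, measure_singleton]
  have hz₀ : ∀ t, t < a → x t = 0 ∧ u t = 0 := fun t ht => by
    have h1 : t ∉ Set.Ico a b := fun h' => by linarith [h'.1]
    have h2 : t ∉ Set.Ico b c := fun h' => by linarith [h'.1]
    have h3 : t ∉ Set.Ico c d := fun h' => by linarith [h'.1]
    simp [hx, hu, h1, h2, h3]
  have hz₁ : ∀ t ∈ Set.Ico a b, x t = x₁ t ∧ u t = u₁ t := fun t h1 => by
    have h2 : t ∉ Set.Ico b c := fun h' => by linarith [h'.1, h1.2]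
    have h3 : t ∉ Set.Ico c d := fun h' => by linarith [h'.1, h1.2]
    simp [hx, hu, h1, h2, h3]
  have hz₂ : ∀ t ∈ Set.Ico b c, x t = x₂ t ∧ u t = u₂ t := fun t h2 => by
    have h1 : t ∉ Set.Ico a b := fun h' => by linarith [h'.2, h2.1]
    have h3 : t ∉ Set.Ico c d := fun h' => by linarith [h'.1, h2.2]
    simp [hx, hu, h1, h2, h3]
  have hz₃ : ∀ t ∈ Set.Ico c d, x t = x₃ t ∧ u t = u₃ t := fun t h3 => by
    have h1 : t ∉ Set.Ico a b := fun h' => by linarith [h'.2, h3.1]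
    have h2 : t ∉ Set.Ico b c := fun h' => by linarith [h'.2, h3.1]
    simp [hx, hu, h1, h2, h3]
  have hz₄ : ∀ t, d ≤ t → x t = 0 ∧ u t = 0 := fun t ht => by
    have h1 : t ∉ Set.Ico a b := fun h' => by linarith [h'.2]
    have h2 : t ∉ Set.Ico b c := fun h' => by linarith [h'.2]
    have h3 : t ∉ Set.Ico c d := fun h' => by linarith [h'.2]
    simp [hx, hu, h1, h2, h3]
  -- The joints are treated from right to left: if a window is empty, the value at its left end is
  -- the one already found at its right end.
  have hxd : x d = x₃ d := by rw [(hz₄ d le_rfl).1, hd]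
  have hxc : x c = x₂ c := by
    rcases hcd.eq_or_lt with rfl | h'
    · rw [hxd, hc]
    · rw [(hz₃ c ⟨le_rfl, h'⟩).1, hc]
  have hxb : x b = x₁ b := by
    rcases hbc.eq_or_lt with rfl | h'
    · rw [hxc, hb]
    · rw [(hz₂ b ⟨le_rfl, h'⟩).1, hb]
  have hxa : x a = 0 := by
    rcases hab.eq_or_lt with rfl | h'
    · rw [hxb, ha]
    · rw [(hz₁ a ⟨le_rfl, h'⟩).1, ha]
  have hpiece : ∀ {e f : ℝ} {y : ℝ → Fin n → ℝ} {v : ℝ → Fin m → ℝ},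
      SatisfiesLTI A B (Set.Icc e f) y v → (∀ t ∈ Set.Ico e f, x t = y t ∧ u t = v t) →
      x f = y f → SatisfiesLTI A B (Set.Icc e f) x u := by
    intro e f y v hyv heq hf
    refine hyv.congr Set.ordConnected_Icc (fun t ht => ?_) ?_
    · rcases ht.2.eq_or_lt with rfl | h'
      · exact hf
      · exact (heq t ⟨ht.1, h'⟩).1
    · filter_upwards [hne f] with t htf ht
      exact (heq t ⟨ht.1, lt_of_le_of_ne ht.2 htf⟩).2
  have hL₀ : SatisfiesLTI A B (Set.Iic a) x u := by
    refine SatisfiesLTI.zero.congr Set.ordConnected_Iic (fun t ht => ?_) ?_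
    · rcases (Set.mem_Iic.1 ht).eq_or_lt with rfl | h'
      · exact hxa
      · exact (hz₀ t h').1
    · filter_upwards [hne a] with t hta ht
      exact (hz₀ t (lt_of_le_of_ne ht hta)).2
  have hL₄ : SatisfiesLTI A B (Set.Ici d) x u :=
    SatisfiesLTI.zero.congr Set.ordConnected_Ici (fun t ht => (hz₄ t ht).1)
      (Filter.Eventually.of_forall fun t ht => (hz₄ t ht).2)
  have hL : SatisfiesLTI A B Set.univ x u := by
    have e1 := hL₀.union (hpiece h₁ hz₁ hxb) (c := a) (by simp) (by simp [hab])
    have e2 := e1.union (hpiece h₂ hz₂ hxc) (c := b) (by simp [hab]) (by simp [hbc])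
    have e3 := e2.union (hpiece h₃ hz₃ hxd) (c := c) (by simp [hbc]) (by simp [hcd])
    have e4 := e3.union hL₄ (c := d) (by simp [hcd]) (by simp)
    refine e4.mono fun t _ => ?_
    by_cases t1 : t ≤ a
    · simp [t1]
    by_cases t2 : t ≤ b
    · simp [t2, (not_le.1 t1).le]
    by_cases t3 : t ≤ c
    · simp [t3, (not_le.1 t2).le]
    by_cases t4 : t ≤ d
    · simp [t4, (not_le.1 t3).le]
    · simp [(not_le.1 t4).le]
  have hxL : MemLp x 2 volume := ((hx₁.memLp_indicator_Ico 2).add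
    (hx₂.memLp_indicator_Ico 2)).add (hx₃.memLp_indicator_Ico 2)
  have huL : MemLp u 2 volume := ((hu₁.memLp_indicator_Ico 2).add
    (hu₂.memLp_indicator_Ico 2)).add (hu₃.memLp_indicator_Ico 2)
  have hxC : ∀ᵐ t, ContinuousAt x t := by
    filter_upwards [hx₁.ae_continuousAt_indicator_Ico, hx₂.ae_continuousAt_indicator_Ico,
      hx₃.ae_continuousAt_indicator_Ico] with t t1 t2 t3
    exact (t1.add t2).add t3
  have huC : ∀ᵐ t, ContinuousAt u t := by
    filter_upwards [hu₁.ae_continuousAt_indicator_Ico, hu₂.ae_continuousAt_indicator_Ico,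
      hu₃.ae_continuousAt_indicator_Ico] with t t1 t2 t3
    exact (t1.add t2).add t3
  have hfin := h x u hxC huC hxL huL (Or.inr hL)
  have hq : ∀ t, M.quad (Sum.elim (x t) (u t)) =
      (Set.Ico a b).indicator (fun t => M.quad (Sum.elim (x₁ t) (u₁ t))) t +
      (Set.Ico b c).indicator (fun t => M.quad (Sum.elim (x₂ t) (u₂ t))) t +
      (Set.Ico c d).indicator (fun t => M.quad (Sum.elim (x₃ t) (u₃ t))) t := by
    intro t
    have hq0 : M.quad (Sum.elim 0 0) = 0 := by simp [quad]
    by_cases h1 : t ∈ Set.Ico a b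
    · have h2 : t ∉ Set.Ico b c := fun h' => by linarith [h'.1, h1.2]
      have h3 : t ∉ Set.Ico c d := fun h' => by linarith [h'.1, h1.2]
      simp [hz₁ t h1, h1, h2, h3]
    by_cases h2 : t ∈ Set.Ico b c
    · have h3 : t ∉ Set.Ico c d := fun h' => by linarith [h'.1, h2.2]
      simp [hz₂ t h2, h1, h2, h3]
    by_cases h3 : t ∈ Set.Ico c d
    · simp [hz₃ t h3, h1, h2, h3]
    have hx0 : x t = 0 := by simp [hx, h1, h2, h3]
    have hu0 : u t = 0 := by simp [hu, h1, h2, h3]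
    rw [hx0, hu0, hq0]
    simp [h1, h2, h3]
  obtain ⟨i1, j1⟩ := (hx₁.quad_sumElim (M := M) hu₁).integral_indicator_Ico hab
  obtain ⟨i2, j2⟩ := (hx₂.quad_sumElim (M := M) hu₂).integral_indicator_Ico hbc
  obtain ⟨i3, j3⟩ := (hx₃.quad_sumElim (M := M) hu₃).integral_indicator_Ico hcd
  simp only [hq] at hfin
  have hadd := integral_add (i1.add i2) i3
  simp only [Pi.add_apply] at hadd
  rw [hadd, integral_add i1 i2, j1, j2, j3] at hfin
  exact hfin

/-- Under the integral quadratic constraint, the costs of loops through a fixed state are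
bounded. -/
lemma exists_loop_integral_le (hAB : Controllable A B)
    (h : ∀ (x : ℝ → Fin n → ℝ) (u : ℝ → Fin m → ℝ),
      (∀ᵐ t, ContinuousAt x t) → (∀ᵐ t, ContinuousAt u t) →
      MemLp x 2 volume → MemLp u 2 volume → (x = 0 ∨ SatisfiesLTI A B Set.univ x u) →
        ∫ t, M.quad (Sum.elim (x t) (u t)) ≤ 0) (v : Fin n → ℝ) :
    ∃ κ : ℝ, ∀ T : ℝ, 0 ≤ T → ∀ (x : ℝ → Fin n → ℝ) (u : ℝ → Fin m → ℝ),
      Continuous x → Continuous u → SatisfiesLTI A B Set.univ x u → x 0 = v → x T = v →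
        ∫ t in (0 : ℝ)..T, M.quad (Sum.elim (x t) (u t)) ≤ κ := by
  obtain ⟨d, hd, x₁, u₁, hx₁, hu₁, h₁, h₁0, h₁1⟩ := hAB 0 v
  obtain ⟨e, he, x₃, u₃, hx₃, hu₃, h₃, h₃0, h₃1⟩ := hAB v 0
  -- The bound is minus the cost of steering from 0 to `v` and from `v` to 0, whatever the loop and
  -- its duration.
  refine ⟨-((∫ t in (0 : ℝ)..d, M.quad (Sum.elim (x₁ t) (u₁ t))) +
    ∫ t in (0 : ℝ)..e, M.quad (Sum.elim (x₃ t) (u₃ t))), fun T hT x u hx hu hxu h0 h1 => ?_⟩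
  have hmaps : Set.MapsTo (fun t => t - (d + T)) (Set.Icc (d + T) (d + T + e))
      (Set.Icc 0 e) := fun t ht => ⟨by linarith [ht.1], by linarith [ht.2]⟩
  have key := loop_integral_nonpos h (a := 0) (b := d) (c := d + T) (d := d + T + e)
    hd (by linarith) (by linarith) hx₁ hu₁
    (x₂ := fun t => x (t - d)) (u₂ := fun t => u (t - d))
    (x₃ := fun t => x₃ (t - (d + T))) (u₃ := fun t => u₃ (t - (d + T)))
    (by fun_prop) (by fun_prop)
    (hx₃.comp (by fun_prop) hmaps) (hu₃.comp (by fun_prop) hmaps)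
    h₁ ((hxu.comp_sub d).mono (by simp)) ((h₃.comp_sub (d + T)).mono hmaps) h₁0
    (by simp [h₁1, h0]) (by simp [h1, h₃0]) (by simp [h₃1])
  rw [intervalIntegral.integral_comp_sub_right (fun t => M.quad (Sum.elim (x t) (u t))),
    intervalIntegral.integral_comp_sub_right (fun t => M.quad (Sum.elim (x₃ t) (u₃ t)))] at key
  simp only [sub_self, add_sub_cancel_left] at key
  linarith

/-- A real sinusoid satisfies the differential equation. -/
lemma satisfiesLTI_sinusoid {p q : Fin n → ℝ} {r s : Fin m → ℝ} {ω : ℝ}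
    (hp : A *ᵥ p + B *ᵥ r = -ω • q) (hq : A *ᵥ q + B *ᵥ s = ω • p) :
    SatisfiesLTI A B Set.univ (fun t => Real.cos (ω * t) • p - Real.sin (ω * t) • q)
      (fun t => Real.cos (ω * t) • r - Real.sin (ω * t) • s) := by
  have heq : ∀ t : ℝ, A *ᵥ (Real.cos (ω * t) • p - Real.sin (ω * t) • q) +
      B *ᵥ (Real.cos (ω * t) • r - Real.sin (ω * t) • s) =
      (-(Real.sin (ω * t) * ω)) • p - (Real.cos (ω * t) * ω) • q := by
    intro t
    have : A *ᵥ (Real.cos (ω * t) • p - Real.sin (ω * t) • q) +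
      B *ᵥ (Real.cos (ω * t) • r - Real.sin (ω * t) • s) =
      Real.cos (ω * t) • (A *ᵥ p + B *ᵥ r) - Real.sin (ω * t) • (A *ᵥ q + B *ᵥ s) := by
      simp only [mulVec_sub, mulVec_smul, smul_add]
      abel
    rw [this, hp, hq]
    module
  intro a _ b _
  simp only [heq]
  have hc : Continuous fun t : ℝ =>
      (-(Real.sin (ω * t) * ω)) • p - (Real.cos (ω * t) * ω) • q := by fun_prop
  refine ⟨hc.intervalIntegrable _ _, ?_⟩
  refine (intervalIntegral.integral_eq_sub_of_hasDerivAt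
    (f := fun t => Real.cos (ω * t) • p - Real.sin (ω * t) • q) (fun t _ => ?_)
    (hc.intervalIntegrable _ _)).symm
  have hid : HasDerivAt (fun t : ℝ => ω * t) ω t := by
    simpa using (hasDerivAt_id t).const_mul ω
  have h1 := hid.cos.smul_const p
  have h2 := hid.sin.smul_const q
  simpa using h1.fun_sub h2

/-- The integral quadratic constraint implies the quadratic constraint on complex sinusoids. -/
lemma hermQuad_nonpos_of_integral (hM : M.IsSymm) (hAB : Controllable A B)
    (h : ∀ (x : ℝ → Fin n → ℝ) (u : ℝ → Fin m → ℝ),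
      (∀ᵐ t, ContinuousAt x t) → (∀ᵐ t, ContinuousAt u t) →
      MemLp x 2 volume → MemLp u 2 volume → (x = 0 ∨ SatisfiesLTI A B Set.univ x u) →
        ∫ t, M.quad (Sum.elim (x t) (u t)) ≤ 0)
    {x : Fin n → ℂ} {u : Fin m → ℂ} {ω : ℝ}
    (hxu : (Complex.I * (ω : ℂ)) • x = A.toComplex *ᵥ x + B.toComplex *ᵥ u) :
    M.hermQuad (Sum.elim x u) ≤ 0 := by
  set p : Fin n → ℝ := fun i => (x i).re with hp
  set q : Fin n → ℝ := fun i => (x i).im with hq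
  set r : Fin m → ℝ := fun i => (u i).re with hr
  set s : Fin m → ℝ := fun i => (u i).im with hs
  have hpr : A *ᵥ p + B *ᵥ r = -ω • q := by
    ext i
    have := congrArg Complex.re (congrFun hxu i)
    simp only [Pi.add_apply, Complex.add_re, toComplex_mulVec_re] at this
    rw [Pi.add_apply, ← this]
    simp [hq]
  have hqs : A *ᵥ q + B *ᵥ s = ω • p := by
    ext i
    have := congrArg Complex.im (congrFun hxu i)
    simp only [Pi.add_apply, Complex.add_im, toComplex_mulVec_im] at this
    rw [Pi.add_apply, ← this]
    simp [hp]
  have hre : (fun i => (Sum.elim x u i).re) = Sum.elim p r := by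
    ext (i | i) <;> rfl
  have him : (fun i => (Sum.elim x u i).im) = Sum.elim q s := by
    ext (i | i) <;> rfl
  -- Two sinusoids are used, the real and imaginary parts of `exp (iωt) (x, u)`, starting at `p` and
  -- at `q`. Their costs add up to a constant integrand, the Hermitian form at `(x, u)`.
  obtain ⟨κ, hκ⟩ := exists_loop_integral_le hAB h p
  obtain ⟨κ', hκ'⟩ := exists_loop_integral_le hAB h q
  -- For `ω = 0` the trajectories are constant, and any positive number serves as period.
  obtain ⟨τ, hτ, hper⟩ : ∃ τ : ℝ, 0 < τ ∧ ∀ N : ℕ,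
      Real.cos (ω * (N * τ)) = 1 ∧ Real.sin (ω * (N * τ)) = 0 := by
    by_cases hω : ω = 0
    · exact ⟨1, one_pos, fun N => by simp [hω]⟩
    · have hcos : ∀ N : ℕ, Real.cos (ω * (N * (2 * Real.pi / |ω|))) = 1 := fun N => by
        rw [← Real.cos_abs, abs_mul, abs_of_nonneg (a := N * (2 * Real.pi / |ω|)) (by positivity)]
        have : |ω| * (N * (2 * Real.pi / |ω|)) = N * (2 * Real.pi) := by
          field_simp
        rw [this, Real.cos_nat_mul_two_pi]
      refine ⟨2 * Real.pi / |ω|, by positivity, fun N => ⟨hcos N, ?_⟩⟩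
      have := Real.sin_sq_add_cos_sq (ω * (N * (2 * Real.pi / |ω|)))
      rw [hcos N] at this
      exact pow_eq_zero_iff two_ne_zero |>.1 (by linarith)
  have hbound : ∀ N : ℕ, (N * τ) * M.hermQuad (Sum.elim x u) ≤ κ + κ' := by
    intro N
    have hT : (0 : ℝ) ≤ N * τ := by positivity
    obtain ⟨hc, hsn⟩ := hper N
    have h1 := hκ (N * τ) hT _ _ (by fun_prop) (by fun_prop) (satisfiesLTI_sinusoid hpr hqs)
      (by simp) (by simp [hc, hsn])
    have h2 := hκ' (N * τ) hT _ _ (by fun_prop) (by fun_prop)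
      (satisfiesLTI_sinusoid (A := A) (B := B) (p := q) (q := -p) (r := s) (s := -r) (ω := ω)
        (by rw [hqs]; simp) (by rw [mulVec_neg, mulVec_neg, ← neg_add, hpr]; simp))
      (by simp) (by simp [hc, hsn])
    refine le_trans (le_of_eq ?_) (add_le_add h1 h2)
    rw [← intervalIntegral.integral_add]
    · have hconst : ∀ t : ℝ,
          M.quad (Sum.elim (Real.cos (ω * t) • p - Real.sin (ω * t) • q)
            (Real.cos (ω * t) • r - Real.sin (ω * t) • s)) +
          M.quad (Sum.elim (Real.cos (ω * t) • q - Real.sin (ω * t) • -p)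
            (Real.cos (ω * t) • s - Real.sin (ω * t) • -r)) =
          M.hermQuad (Sum.elim x u) := by
        intro t
        have e1 : Sum.elim (Real.cos (ω * t) • p - Real.sin (ω * t) • q)
            (Real.cos (ω * t) • r - Real.sin (ω * t) • s) =
            Real.cos (ω * t) • Sum.elim p r - Real.sin (ω * t) • Sum.elim q s := by
          ext (i | i) <;> simp
        have e2 : Sum.elim (Real.cos (ω * t) • q - Real.sin (ω * t) • -p)
            (Real.cos (ω * t) • s - Real.sin (ω * t) • -r) =
            Real.cos (ω * t) • Sum.elim q s + Real.sin (ω * t) • Sum.elim p r := by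
          ext (i | i) <;> simp
        rw [e1, e2, hermQuad, hre, him]
        simp only [quad, mulVec_add, mulVec_sub, mulVec_smul, add_dotProduct, sub_dotProduct,
          dotProduct_add, dotProduct_sub, smul_dotProduct, dotProduct_smul, smul_eq_mul,
          hM.dotProduct_mulVec_comm (Sum.elim q s) (Sum.elim p r)]
        linear_combination (Sum.elim p r ⬝ᵥ M *ᵥ Sum.elim p r + Sum.elim q s ⬝ᵥ M *ᵥ Sum.elim q s) *
          Real.sin_sq_add_cos_sq (ω * t)
      simp only [hconst, intervalIntegral.integral_const, sub_zero, smul_eq_mul]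
    · exact ContinuousOn.intervalIntegrable (ContinuousOn.quad_sumElim
        (Continuous.continuousOn (by fun_prop)) (Continuous.continuousOn (by fun_prop)))
    · exact ContinuousOn.intervalIntegrable (ContinuousOn.quad_sumElim
        (Continuous.continuousOn (by fun_prop)) (Continuous.continuousOn (by fun_prop)))
  -- A positive value would make the left side of `hbound` grow linearly in `N` past a fixed bound.
  by_contra! hpos
  obtain ⟨N, hN⟩ := exists_nat_gt ((κ + κ') / (τ * M.hermQuad (Sum.elim x u)))
  rw [div_lt_iff₀ (mul_pos hτ hpos)] at hN
  linarith [hbound N]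

/-- The alternative `x = 0` leaves the input free of the differential equation, so a constant pulse
on `[0, 1)` tests the form at any real `v`. -/
lemma hermQuad_zero_nonpos_of_integral
    (h : ∀ (x : ℝ → Fin n → ℝ) (u : ℝ → Fin m → ℝ),
      (∀ᵐ t, ContinuousAt x t) → (∀ᵐ t, ContinuousAt u t) →
      MemLp x 2 volume → MemLp u 2 volume → (x = 0 ∨ SatisfiesLTI A B Set.univ x u) →
        ∫ t, M.quad (Sum.elim (x t) (u t)) ≤ 0) (u : Fin m → ℂ) :
    M.hermQuad (Sum.elim 0 u) ≤ 0 := by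
  have key : ∀ v : Fin m → ℝ, M.quad (Sum.elim 0 v) ≤ 0 := by
    intro v
    have hc : ContinuousOn (fun _ : ℝ => v) (Set.Icc 0 1) := continuousOn_const
    have h1 := h 0 ((Set.Ico 0 1).indicator fun _ => v)
      (Filter.Eventually.of_forall fun t => continuousAt_const)
      hc.ae_continuousAt_indicator_Ico MemLp.zero (hc.memLp_indicator_Ico 2) (Or.inl rfl)
    have h2 : ∀ t : ℝ, M.quad (Sum.elim ((0 : ℝ → Fin n → ℝ) t)
        ((Set.Ico 0 1).indicator (fun _ => v) t)) =
        (Set.Ico (0 : ℝ) 1).indicator (fun _ => M.quad (Sum.elim 0 v)) t := fun t => by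
      by_cases ht : t ∈ Set.Ico (0 : ℝ) 1
      · simp [ht]
      · simp [ht, quad]
    simp only [h2] at h1
    rw [(ContinuousOn.integral_indicator_Ico zero_le_one continuousOn_const).2] at h1
    simpa using h1
  have hre : (fun i => (Sum.elim (0 : Fin n → ℂ) u i).re) =
      Sum.elim (0 : Fin n → ℝ) fun i => (u i).re := by
    ext (i | i) <;> rfl
  have him : (fun i => (Sum.elim (0 : Fin n → ℂ) u i).im) =
      Sum.elim (0 : Fin n → ℝ) fun i => (u i).im := by
    ext (i | i) <;> rfl
  rw [hermQuad, hre, him]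
  exact add_nonpos (key _) (key _)

end Loop

theorem proposition2 (n m : ℕ) (A : Matrix (Fin n) (Fin n) ℝ) (B : Matrix (Fin n) (Fin m) ℝ)
    (M : Matrix (Fin n ⊕ Fin m) (Fin n ⊕ Fin m) ℝ) (hM : M.IsSymm) (hAB : Controllable A B) :
    List.TFAE [
      -- (i) the linear matrix inequality
      ∃ P : Matrix (Fin n) (Fin n) ℝ, P.IsSymm ∧
        (-(M + Matrix.fromBlocks (Aᵀ * P + P * A) (P * B) (Bᵀ * P) 0)).PosSemidef,
      -- (ii) the complex quadratic constraint
      ∀ (x : Fin n → ℂ) (u : Fin m → ℂ),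
        (x = 0 ∨ ∃ ω : ℝ, (Complex.I * (ω : ℂ)) • x = A.toComplex *ᵥ x + B.toComplex *ᵥ u) →
          star (Sum.elim x u) ⬝ᵥ (M.toComplex *ᵥ Sum.elim x u) ≤ 0,
      -- (iii) the integral quadratic constraint over square-integrable trajectories
      ∀ (x : ℝ → Fin n → ℝ) (u : ℝ → Fin m → ℝ),
        (∀ᵐ t, ContinuousAt x t) → (∀ᵐ t, ContinuousAt u t) →
        MemLp x 2 volume → MemLp u 2 volume →
        (x = 0 ∨ SatisfiesLTI A B Set.univ x u) →
          ∫ t, Sum.elim (x t) (u t) ⬝ᵥ (M *ᵥ Sum.elim (x t) (u t)) ≤ 0,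
      -- (iv) the frequency-domain inequality
      ∀ ω : ℝ, ¬ Module.End.HasEigenvalue (Matrix.toLin' A.toComplex) (Complex.I * (ω : ℂ)) →
        (-((frequencyMatrix A B ω)ᴴ * M.toComplex * frequencyMatrix A B ω)).PosSemidef] := by
  -- In `ℂ` the relation `z ≤ 0` includes that `z` is real; the symmetry of `M` guarantees this, and
  -- (ii) and (iv) become inequalities for `hermQuad`.
  have hreal : ∀ r : ℝ, (r : ℂ) ≤ 0 ↔ r ≤ 0 := fun r => by
    rw [← Complex.ofReal_zero, Complex.real_le_real]
  simp only [hM.star_dotProduct_toComplex_mulVec, hreal,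
    posSemidef_neg_frequency_iff hM, not_hasEigenvalue_toLin'_iff]
  tfae_have 1 → 3 := by
    rintro ⟨P, hP, h⟩ x u _ _ hx hu (rfl | hxu)
    · exact integral_nonpos fun t => quad_sumElim_zero_nonpos hP h (u t)
    · exact integral_quad_nonpos hP h hx hu hxu
  tfae_have 3 → 2 := by
    rintro h x u (rfl | ⟨ω, hxu⟩)
    · exact hermQuad_zero_nonpos_of_integral h u
    · exact hermQuad_nonpos_of_integral hM hAB h hxu
  tfae_have 2 → 1 := exists_lmi_of_hermQuad hM hAB
  tfae_have 2 → 4 := by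
    intro h ω hω u
    rw [frequencyMatrix_mulVec]
    refine h _ _ (Or.inr ⟨ω, ?_⟩)
    rw [← sub_eq_iff_eq_add']
    nth_rw 1 [← one_mulVec (_⁻¹ *ᵥ _)]
    rw [← smul_mulVec, ← sub_mulVec, mulVec_mulVec,
      mul_nonsing_inv _ ((isUnit_iff_isUnit_det _).1 hω), one_mulVec]
  tfae_have 4 → 2 := by
    rintro h x u (rfl | ⟨ω, hxu⟩)
    · exact hermQuad_zero_nonpos_of_frequency h u
    · exact hermQuad_nonpos_of_frequency hAB h hxu
  tfae_finish
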